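/- Let $\varepsilon_8$ be the complex simple Lie algebra of type $\mathrm{E}_8$, with a Cartan subalgebra $\mathfrak h$ and simple roots $\alpha_1,\dots,\alpha_8$ numbered as in Bourbaki, and let $\omega_i\in\mathfrak h$ be defined by $\alpha_j(\omega_i)=\delta_{ij}$. A *copy* of $\mathfrak{sl}_2=\mathfrak{sl}_2(\mathbb C)$ in $\varepsilon_8$ is given by an injective Lie algebra homomorphism $\varphi\colon\mathfrak{sl}_2\to\varepsilon_8$; write $h=\varphi(\mathrm{diag}(1,-1))$. The *weights* of $\varepsilon_8$ for the copy are the eigenvalues of $\operatorname{ad}h$ on $\varepsilon_8$. Its *Dynkin index* is $(h,h)/2$, where $(\,,)$ is the Weyl-invariant symmetric bilinear form, on a Cartan subalgebra of $\varepsilon_8$ containing $h$, for which all coroots have square length $2$. Two copies are *conjugate* if an automorphism of $\varepsilon_8$ carries the one subalgebra onto the other. The copy *generated by a root* $\alpha$ sends the standard elements $h,e,f$ of $\mathfrak{sl}_2$ to the coroot $\alpha^\vee$ and into the root spaces of $\alpha$ and $-\alpha$. (a) Let $\psi_1$ be a copy generated by the highest root of $\mathrm{E}_8$. Such copies exist;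 each has Dynkin index $1$ and $h=\omega_8$. (b) Let $\psi_2$ be an $\mathfrak{sl}_2$ embedded diagonally in $\mathfrak{sl}_2\times\mathfrak{sl}_2\subset\varepsilon_8$, where the first factor is generated by the highest root of $\mathrm{E}_8$ and the second by the highest root of the $\mathrm{E}_7$ subsystem with simple roots $\alpha_1,\dots,\alpha_7$. Such copies exist; each has Dynkin index $2$ and $h=\omega_1$. (c) For every copy of $\mathfrak{sl}_2$ in $\varepsilon_8$, and for every choice of $\psi_1$ and $\psi_2$ as above, the following are equivalent: 1. $1$ and $-1$ are weights of $\varepsilon_8$, and no other odd integer is a weight; 2. every weight of $\varepsilon_8$ lies in $\{0,\pm1,\pm2\}$; 3. the Dynkin index of the copy is $1$ or $2$; 4. the copy is conjugate to $\psi_1$ or to $\psi_2$. -/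

import Mathlib

open LieAlgebra LieAlgebra.IsKilling

noncomputable section

namespace SlTwoCopies

/-- The complex Lie algebra `sl₂` of traceless `2 × 2` matrices. -/
abbrev SlTwo : Type := LieAlgebra.SpecialLinear.sl (Fin 2) ℂ

/-- The standard element `h = diag(1, -1)`, the coroot of `sl₂`. -/
def hStd : SlTwo :=
  ⟨!![1, 0; 0, -1], by
    simp [LieAlgebra.SpecialLinear.sl, Matrix.trace_fin_two]⟩

/-- The standard element `e`. -/
def eStd : SlTwo :=
  ⟨!![0, 1; 0, 0], by
    simp [LieAlgebra.SpecialLinear.sl, Matrix.trace_fin_two]⟩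

/-- The standard element `f`. -/
def fStd : SlTwo :=
  ⟨!![0, 0; 1, 0], by
    simp [LieAlgebra.SpecialLinear.sl, Matrix.trace_fin_two]⟩

section Rep

variable {L : Type*} [LieRing L] [LieAlgebra ℂ L]

/-- `μ` is a weight of `L`, regarded as a representation of `sl₂` through `φ` and the adjoint
representation: an eigenvalue of `h` acting on `L`. -/
def IsWeight (φ : SlTwo →ₗ⁅ℂ⁆ L) (μ : ℂ) : Prop :=
  Module.End.HasEigenvalue (LieAlgebra.ad ℂ L (φ hStd)) μ

/-- Two copies of `sl₂` are conjugate if some automorphism of the Lie algebra `L` maps the one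
subalgebra onto the other. -/
def AreConjugate (φ ψ : SlTwo →ₗ⁅ℂ⁆ L) : Prop :=
  ∃ σ : L ≃ₗ⁅ℂ⁆ L, φ.range.map σ.toLieHom = ψ.range

end Rep

section RootSystem

variable {ι M N : Type*} [AddCommGroup M] [Module ℂ M] [AddCommGroup N] [Module ℂ N]

/-- The subsystem generated by a set `J` of roots: all roots that are integral combinations
of the members of `J`. -/
def subsystem (P : RootPairing ι ℂ M N) (J : Set ι) : Set ι :=
  {α | P.root α ∈ Submodule.span ℤ (P.root '' J)}

/-- `θ` is the highest root of the subsystem with the set `J` of simple roots: it belongs to the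
subsystem, and for every root `β` of the subsystem the difference `θ - β` is a sum of members
of `J`. -/
def IsHighestRoot (P : RootPairing ι ℂ M N) (J : Set ι) (θ : ι) : Prop :=
  θ ∈ subsystem P J ∧
    ∀ β ∈ subsystem P J, P.root θ - P.root β ∈ AddSubmonoid.closure (P.root '' J)

/-- A symmetric Weyl-invariant bilinear form on the space spanned by the coroots, normalized so
that the short coroots have square length `2`: the value `2` is attained at some coroot and is
the least value at coroots. -/
structure IsNormalizedForm (P : RootPairing ι ℂ M N) (B : LinearMap.BilinForm ℂ N) : Prop where
  symm : ∀ x y, B x y = B y x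
  weyl_invariant : ∀ α x y, B (P.coreflection α x) (P.coreflection α y) = B x y
  attained : ∃ α, B (P.coroot α) (P.coroot α) = 2
  minimal : ∀ α, 2 ≤ (B (P.coroot α) (P.coroot α)).re

end RootSystem

section Simple

variable {L : Type*} [LieRing L] [LieAlgebra ℂ L] [FiniteDimensional ℂ L]
  [LieAlgebra.IsSimple ℂ L]

/-- The inclusion `φ` of `sl₂` into the simple Lie algebra `L` has Dynkin index `d`: for a Cartan
subalgebra `H` of `L` that contains the image `φ h` of the Cartan subalgebra `ℂ h` of `sl₂`, and
for the normalized form `B` on `H`, the number `d` is the ratio of `B (φ h) (φ h)` to `2`, the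
square length of the coroot `h` of `sl₂` for the normalized form of `sl₂`. -/
def HasDynkinIndex (φ : SlTwo →ₗ⁅ℂ⁆ L) (d : ℂ) : Prop :=
  ∃ (H : LieSubalgebra ℂ L) (_ : H.IsCartanSubalgebra) (hmem : φ hStd ∈ H)
    (B : LinearMap.BilinForm ℂ H), IsNormalizedForm (rootSystem H) B ∧
      B ⟨φ hStd, hmem⟩ ⟨φ hStd, hmem⟩ / 2 = d

variable {H : LieSubalgebra ℂ L} [H.IsCartanSubalgebra]

/-- `φ` is the copy of `sl₂` generated by the root `α`: `h` goes to the coroot of `α`, and `e` and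
`f` go to the root spaces of `α` and `-α`. -/
def IsRootCopy (α : H.root) (φ : SlTwo →ₗ⁅ℂ⁆ L) : Prop :=
  φ hStd = ((rootSystem H).coroot α : H) ∧
    φ eStd ∈ rootSpace H (α.1 : H → ℂ) ∧
    φ fStd ∈ rootSpace H (-(α.1 : H → ℂ))

/-- `ν` numbers the simple roots in the base `b` as in Bourbaki, from `0` to `7`
in place of `1` to `8`, so that the root system has type `E₈`. -/
def IsNumberingEEight (b : (rootSystem H).Base) (ν : Fin 8 ≃ b.support) : Prop :=
  ∀ i j, b.cartanMatrix (ν i) (ν j) = CartanMatrix.E₈ i j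

/-- The element `x` of `L` is the fundamental (co)weight dual to the simple root `ν i`: it lies
in the Cartan subalgebra `H`, and `ν j` takes the value `δ_{ij}` at it. -/
def IsFundamental (b : (rootSystem H).Base) (ν : Fin 8 ≃ b.support) (i : Fin 8) (x : L) : Prop :=
  ∃ hx : x ∈ H, ∀ j, (rootSystem H).root (ν j) ⟨x, hx⟩ = if j = i then 1 else 0

/-- The copy of `sl₂` generated by the highest root. -/
def IsHighestRootCopy (b : (rootSystem H).Base) (φ : SlTwo →ₗ⁅ℂ⁆ L) : Prop :=
  ∃ θ : H.root, IsHighestRoot (rootSystem H) b.support θ ∧ IsRootCopy θ φ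

/-- The copy of `sl₂` embedded diagonally in the product of the copies generated by the highest
root and by the highest root of the `E₇` subsystem, whose simple roots are the first seven. -/
def IsDiagonalCopy (b : (rootSystem H).Base) (ν : Fin 8 ≃ b.support) (φ : SlTwo →ₗ⁅ℂ⁆ L) : Prop :=
  ∃ (θ θ' : H.root) (φ₁ φ₂ : SlTwo →ₗ⁅ℂ⁆ L),
    IsHighestRoot (rootSystem H) b.support θ ∧
    IsHighestRoot (rootSystem H) {α | ∃ i : Fin 8, i ≠ 7 ∧ α = ν i} θ' ∧
    IsRootCopy θ φ₁ ∧ IsRootCopy θ' φ₂ ∧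
    ∀ x, φ x = φ₁ x + φ₂ x

end Simple

end SlTwoCopies

end

/-! A copy of `sl₂` is determined up to conjugacy by its neutral element `h`, and in type `E₈` every
`h` can be moved to a dominant vector of the coroot lattice; the theorem then becomes a statement
about that lattice.

The reduction has four ingredients. On a finite-dimensional `sl₂`-module `h` acts without Jordan
blocks (`lie_h_eq_smul_of_lie_lie`), so `h` lies in a Cartan subalgebra. Any two Cartan subalgebras
are conjugate (`exists_lieEquiv_isCartanSubalgebra`), so `h` may be moved into `H`. The roots take
integral values there and the lattice `E₈` is unimodular, so `h` is an integral combination of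
coroots; reflections lift to automorphisms (`exists_lieEquiv_reflection`), which makes it dominant.
Finally, two triples with the same `h` are conjugate (`exists_lieEquiv_of_isSl2Triple`). Both
conjugacy theorems rest on one argument: the exponentials of `ad y` fill a neighbourhood of a good
point, and the good points on a complex line form a connected set, being all but finitely many.

The weights are then zero and the values of the roots at `h`, and the index is half the square
length of `h`. The equivalence is proved as a cycle 1 → 2 → 4 → 3 → 1. For 1 → 2, a root with even
value has a non-orthogonal root with odd value, and their sum or difference is a root with odd
value; all odd values being `±1`, the even one is `0` or `±2`. For 2 → 4, the highest root has
coefficients `2, 3, 4, 6, 5, 4, 3, 2`, so a value of at most `2` at a nonzero dominant `h` leaves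
only `ω₈` and `ω₁`, the neutral elements of `ψ₁` and `ψ₂`. For 4 → 3, the Killing form of `h`
depends only on the subalgebra up to conjugacy. For 3 → 1, the dominant vectors of square length `2`
and `4` are again `ω₈` and `ω₁`, and the coefficient `2` of the highest root bounds the values of
the roots. -/

open LieAlgebra LieAlgebra.IsKilling

noncomputable section

namespace SlTwoCopies

/-! ### Exponentials of derivations and the open mapping argument. -/

section NormedExp

open NormedSpace

variable {E : Type*} [NormedAddCommGroup E] [NormedSpace ℂ E] [CompleteSpace E]

lemma exp_clm_comp_exp_neg (D : E →L[ℂ] E) (z : E) : exp D (exp (-D) z) = z := by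
  let _ : NormedAlgebra ℚ (E →L[ℂ] E) := NormedAlgebra.restrictScalars ℚ ℂ _
  have h : exp D * exp (-D) = 1 := by
    rw [← exp_add_of_commute (Commute.neg_right (Commute.refl D)), add_neg_cancel, exp_zero]
  exact congrArg (fun f : E →L[ℂ] E => f z) h

lemma exp_clm_neg_comp_exp (D : E →L[ℂ] E) (z : E) : exp (-D) (exp D z) = z := by
  simpa using exp_clm_comp_exp_neg (-D) z

/-- The exponential of a derivation of a bilinear product is multiplicative. -/
lemma exp_derivation_apply (m : E →L[ℂ] E →L[ℂ] E) (D : E →L[ℂ] E)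
    (hD : ∀ x y, D (m x y) = m (D x) y + m x (D y)) (x y : E) :
    exp D (m x y) = m (exp D x) (exp D y) := by
  have hexp (z : E) (t : ℂ) :
      HasDerivAt (fun u : ℂ => exp (u • D) z) (D (exp (t • D) z)) t := by
    simpa using (hasDerivAt_exp_smul_const' (𝕂 := ℂ) D t).clm_apply (hasDerivAt_const t z)
  have hprod (t : ℂ) : HasDerivAt (fun u : ℂ => m (exp (u • D) x) (exp (u • D) y))
      (D (m (exp (t • D) x) (exp (t • D) y))) t := by
    have h1 : HasDerivAt (fun u : ℂ => m (exp (u • D) x)) (m (D (exp (t • D) x))) t :=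
      m.hasFDerivAt.comp_hasDerivAt t (hexp x t)
    rw [hD]
    exact h1.clm_apply (hexp y t)
  -- The curve `exp (-u D) (m (exp (u D) x) (exp (u D) y))` is constant; comparing its values at `1`
  -- and `0` gives the claim.
  have hderiv (t : ℂ) : HasDerivAt
      (fun u : ℂ => exp (u • (-D)) (m (exp (u • D) x) (exp (u • D) y))) 0 t := by
    have h1 := (hasDerivAt_exp_smul_const (𝕂 := ℂ) (-D) t).clm_apply (hprod t)
    refine h1.congr_deriv ?_
    simp
  have hconst := is_const_of_deriv_eq_zero (fun t => (hderiv t).differentiableAt)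
    (fun t => (hderiv t).deriv) 1 0
  simp only [one_smul, zero_smul, exp_zero] at hconst
  have := congrArg (fun z => exp D z) hconst
  rw [exp_clm_comp_exp_neg] at this
  simpa using this.symm

lemma hasSum_exp_clm_apply (D : E →L[ℂ] E) (z : E) :
    HasSum (fun n : ℕ => ((n.factorial : ℂ)⁻¹) • (D ^ n) z) (exp D z) := by
  have := (exp_series_hasSum_exp' (𝕂 := ℂ) D).mapL (ContinuousLinearMap.apply ℂ E z)
  simpa using this

lemma exp_clm_apply_of_pow_three (D : E →L[ℂ] E) (z : E) (hz : D (D (D z)) = 0) :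
    exp D z = z + D z + (2⁻¹ : ℂ) • D (D z) := by
  have hpow (n : ℕ) : (D ^ (n + 3)) z = 0 := by
    rw [pow_add]; simp [pow_succ, hz]
  have h2 : HasSum (fun n : ℕ => ((n.factorial : ℂ)⁻¹) • (D ^ n) z)
      (∑ n ∈ Finset.range 3, ((n.factorial : ℂ)⁻¹) • (D ^ n) z) := by
    refine hasSum_sum_of_ne_finset_zero fun n hn => ?_
    obtain ⟨k, rfl⟩ := Nat.exists_eq_add_of_le (not_lt.mp (Finset.mem_range.not.mp hn))
    rw [add_comm, hpow, smul_zero]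
  rw [(hasSum_exp_clm_apply D z).unique h2]
  simp [Finset.sum_range_succ, Nat.factorial]

lemma exp_clm_apply_mem [FiniteDimensional ℂ E] (D : E →L[ℂ] E) (N : Submodule ℂ E)
    (hN : ∀ z ∈ N, D z ∈ N) (z : E) (hz : z ∈ N) : exp D z ∈ N := by
  have hpow (n : ℕ) : (D ^ n) z ∈ N := by
    induction n with
    | zero => simpa using hz
    | succ n ih => rw [pow_succ']; exact hN _ ih
  have hs := (hasSum_exp_clm_apply D z)
  refine N.closed_of_finiteDimensional.mem_of_tendsto hs (Filter.Eventually.of_forall fun s => ?_)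
  exact N.sum_mem fun n _ => N.smul_mem _ (hpow n)

/-- If the tangent map `(y, k) ↦ m y x + k` is onto, then the points `exp (m y) (x + k)` fill a
neighbourhood of `x`. -/
lemma eventually_exists_exp [FiniteDimensional ℂ E] (m : E →L[ℂ] E →L[ℂ] E)
    (A K : Submodule ℂ E) (x : E) (h : ∀ z, ∃ y ∈ A, ∃ k ∈ K, z = m y x + k) :
    ∀ᶠ z in nhds x, ∃ y ∈ A, ∃ k ∈ K, z = exp (m y) (x + k) := by
  let F : A × K → E := fun p => exp (m p.1) (x + p.2)
  have h1 : HasStrictFDerivAt (fun p : A × K => m p.1)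
      (m ∘L A.subtypeL ∘L ContinuousLinearMap.fst ℂ A K) 0 :=
    (m ∘L A.subtypeL ∘L ContinuousLinearMap.fst ℂ A K).hasStrictFDerivAt
  have h2 : HasStrictFDerivAt (fun p : A × K => exp (m p.1))
      ((1 : (E →L[ℂ] E) →L[ℂ] (E →L[ℂ] E)) ∘L
        (m ∘L A.subtypeL ∘L ContinuousLinearMap.fst ℂ A K)) 0 := by
    refine HasStrictFDerivAt.comp (g := fun T : E →L[ℂ] E => exp T) 0 ?_ h1
    simpa using (hasStrictFDerivAt_exp_zero (𝕂 := ℂ) (𝔸 := E →L[ℂ] E))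
  have h3 : HasStrictFDerivAt (fun p : A × K => x + (p.2 : E))
      (K.subtypeL ∘L ContinuousLinearMap.snd ℂ A K) 0 :=
    (K.subtypeL ∘L ContinuousLinearMap.snd ℂ A K).hasStrictFDerivAt.const_add x
  have h4 := h2.clm_apply h3
  -- The derivative of `F` at `0` is `(y, k) ↦ m y x + k`, which is onto by `h`, so `F` maps
  -- neighbourhoods of `0` onto neighbourhoods of `x`.
  have h5 := h4.map_nhds_eq_of_surj (by
    rw [LinearMap.range_eq_top]
    intro z
    obtain ⟨y, hy, k, hk, rfl⟩ := h z
    exact ⟨(⟨y, hy⟩, ⟨k, hk⟩), by simp [add_comm]⟩)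
  have h6 : ∀ᶠ z in Filter.map F (nhds 0), ∃ y ∈ A, ∃ k ∈ K, z = exp (m y) (x + k) :=
    Filter.eventually_map.mpr (Filter.Eventually.of_forall fun p =>
      ⟨p.1, p.1.2, p.2, p.2.2, rfl⟩)
  have h7 : F 0 = x := by simp [F]
  have h8 : Filter.map F (nhds 0) = nhds x := by rw [← h7]; exact h5
  rwa [h8] at h6

end NormedExp

/-! ### The automorphisms `exp (ad y)`. -/

section ExpAd

variable {L : Type*} [LieRing L] [LieAlgebra ℂ L]

/-- The properties used of the automorphism `exp (ad y)`. -/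
structure IsExpAd (y : L) (σ : L ≃ₗ⁅ℂ⁆ L) : Prop where
  map_mem : ∀ N : Submodule ℂ L, (∀ z ∈ N, ⁅y, z⁆ ∈ N) → ∀ z ∈ N, σ z ∈ N
  symm_map_mem : ∀ N : Submodule ℂ L, (∀ z ∈ N, ⁅y, z⁆ ∈ N) → ∀ z ∈ N, σ.symm z ∈ N
  apply_of_lie_lie_lie : ∀ z, ⁅y, ⁅y, ⁅y, z⁆⁆⁆ = 0 → σ z = z + ⁅y, z⁆ + (2⁻¹ : ℂ) • ⁅y, ⁅y, z⁆⁆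

lemma IsExpAd.apply_of_lie_eq_zero {y : L} {σ : L ≃ₗ⁅ℂ⁆ L} (h : IsExpAd y σ) {z : L}
    (hz : ⁅y, z⁆ = 0) : σ z = z := by
  simpa [hz] using h.apply_of_lie_lie_lie z (by simp [hz])

variable [FiniteDimensional ℂ L]

/-- A norm on `L` is chosen inside the proof only. The neighbourhood of `x` is tested along the
complex lines `x + t • v`, so that the statement needs no topology on `L`. -/
lemma exists_isExpAd_aux :
    ∃ Φ : L → L ≃ₗ⁅ℂ⁆ L, (∀ y, IsExpAd y (Φ y)) ∧
      ∀ (A K : Submodule ℂ L) (x : L), (∀ z, ∃ y ∈ A, ∃ k ∈ K, z = ⁅y, x⁆ + k) →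
        ∀ v : L, ∀ᶠ t : ℂ in nhds 0, ∃ y ∈ A, ∃ k ∈ K, x + t • v = Φ y (x + k) := by
  let e : L ≃ₗ[ℂ] EuclideanSpace ℂ (Fin (Module.finrank ℂ L)) :=
    LinearEquiv.ofFinrankEq _ _ (by simp)
  let _ : NormedAddCommGroup L := NormedAddCommGroup.induced L _ e e.injective
  let _ : NormedSpace ℂ L := NormedSpace.induced ℂ L _ e
  have : CompleteSpace L := FiniteDimensional.complete ℂ L
  let m : L →L[ℂ] L →L[ℂ] L := LinearMap.toContinuousLinearMap
    ((LinearMap.toContinuousLinearMap (𝕜 := ℂ) (E := L) (F' := L)).toLinearMap ∘ₗ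
      (LieAlgebra.ad ℂ L : L →ₗ[ℂ] Module.End ℂ L))
  have hm (x y : L) : m x y = ⁅x, y⁆ := rfl
  let Φ (y : L) : L ≃ₗ⁅ℂ⁆ L :=
    { toFun := fun z => NormedSpace.exp (m y) z
      map_add' := map_add _
      map_smul' := map_smul _
      map_lie' := by
        intro a b
        exact exp_derivation_apply m (m y) (fun a b => by simp [hm]) a b
      invFun := fun z => NormedSpace.exp (-(m y)) z
      left_inv := exp_clm_neg_comp_exp (m y)
      right_inv := exp_clm_comp_exp_neg (m y) }
  refine ⟨Φ, fun y => ⟨fun N hN z hz => exp_clm_apply_mem (m y) N hN z hz,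
    fun N hN z hz => exp_clm_apply_mem (-(m y)) N (fun z hz => N.neg_mem (hN z hz)) z hz,
    fun z hz => exp_clm_apply_of_pow_three (m y) z hz⟩, fun A K x h v => ?_⟩
  have h1 := eventually_exists_exp m A K x h
  have h2 : Filter.Tendsto (fun t : ℂ => x + t • v) (nhds 0) (nhds x) := by
    have : Continuous (fun t : ℂ => x + t • v) := by fun_prop
    simpa using this.tendsto 0
  exact h2.eventually h1

lemma exists_isExpAd (y : L) : ∃ σ : L ≃ₗ⁅ℂ⁆ L, IsExpAd y σ := by
  obtain ⟨Φ, hΦ, -⟩ := exists_isExpAd_aux (L := L)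
  exact ⟨Φ y, hΦ y⟩

/-- If `⁅A, x⁆ + K = L`, then the points near `x` are conjugate to points of `x + K` by
exponentials of elements of `A`. -/
lemma eventually_exists_isExpAd (A K : Submodule ℂ L) (x : L)
    (h : ∀ z, ∃ y ∈ A, ∃ k ∈ K, z = ⁅y, x⁆ + k) (v : L) :
    ∀ᶠ t : ℂ in nhds 0, ∃ y ∈ A, ∃ σ : L ≃ₗ⁅ℂ⁆ L, IsExpAd y σ ∧ ∃ k ∈ K, x + t • v = σ (x + k) := by
  obtain ⟨Φ, hΦ, h'⟩ := exists_isExpAd_aux (L := L)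
  filter_upwards [h' A K x h v] with t ⟨y, hy, k, hk, hyk⟩
  exact ⟨y, hy, Φ y, hΦ y, k, hk, hyk⟩

end ExpAd

/-- A locally constant relation on the complement of a countable set of complex numbers is
universal. -/
lemma rel_of_eventually_rel {S : Set ℂ} (hS : S.Countable) (P : ℂ → ℂ → Prop)
    (hsymm : ∀ x y, P x y → P y x) (htrans : ∀ x y z, P x y → P y z → P x z)
    (hloc : ∀ x ∉ S, ∀ᶠ y in nhds x, y ∉ S → P x y) {x y : ℂ} (hx : x ∉ S) (hy : y ∉ S) :
    P x y := by
  -- The plane `ℂ` has real dimension `2`, so removing a countable set leaves it connected.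
  have hconn : IsPreconnected Sᶜ :=
    (hS.isConnected_compl_of_one_lt_rank (by simp)).isPreconnected
  refine hconn.induction₂ P (fun x hx => ?_) (fun x y z _ _ _ => htrans x y z)
    (fun x y _ _ => hsymm x y) hx hy
  rw [eventually_nhdsWithin_iff]
  exact hloc x hx

/-! ### Conjugacy of Cartan subalgebras. -/

section CartanConjugacy

open LieSubalgebra Module

variable {L : Type*} [LieRing L] [LieAlgebra ℂ L]

lemma lieEquiv_ad_pow (σ : L ≃ₗ⁅ℂ⁆ L) (x y : L) (n : ℕ) :
    ((ad ℂ L (σ x)) ^ n) (σ y) = σ (((ad ℂ L x) ^ n) y) := by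
  induction n with
  | zero => simp
  | succ n ih =>
    rw [pow_succ', pow_succ', Module.End.mul_apply, Module.End.mul_apply, ih, ad_apply, ad_apply]
    exact (σ.toLieHom.map_lie _ _).symm

lemma lieEquiv_mem_engel_iff (σ : L ≃ₗ⁅ℂ⁆ L) (x y : L) :
    σ y ∈ engel ℂ (σ x) ↔ y ∈ engel ℂ x := by
  simp only [mem_engel_iff, lieEquiv_ad_pow, EmbeddingLike.map_eq_zero_iff]

lemma finrank_engel_lieEquiv (σ : L ≃ₗ⁅ℂ⁆ L) (x : L) :
    finrank ℂ (engel ℂ (σ x)) = finrank ℂ (engel ℂ x) := by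
  have h : (engel ℂ (σ x)).toSubmodule =
      (engel ℂ x).toSubmodule.map (σ.toLinearEquiv : L →ₗ[ℂ] L) := by
    ext z
    rw [Submodule.mem_map]
    constructor
    · intro hz
      exact ⟨σ.symm z, (lieEquiv_mem_engel_iff σ _ _).mp (by simpa using hz), by simp⟩
    · rintro ⟨w, hw, rfl⟩
      exact (lieEquiv_mem_engel_iff σ _ _).mpr hw
  change finrank ℂ (engel ℂ (σ x)).toSubmodule = _
  rw [h]
  exact LinearEquiv.finrank_map_eq σ.toLinearEquiv _

lemma le_engel_of_isCartanSubalgebra (H : LieSubalgebra ℂ L) [H.IsCartanSubalgebra] {x : L}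
    (hx : x ∈ H) : H ≤ engel ℂ x := by
  intro y hy
  obtain ⟨k, hk⟩ := LieModule.exists_forall_pow_toEnd_eq_zero ℂ H H
  have h := LinearMap.congr_fun (hk ⟨x, hx⟩) ⟨y, hy⟩
  have key (n : ℕ) : ((((LieModule.toEnd ℂ H H ⟨x, hx⟩) ^ n) ⟨y, hy⟩ : H) : L) =
      ((ad ℂ L x) ^ n) y := by
    induction n with
    | zero => rfl
    | succ n ih => simp [pow_succ', ← ih]
  rw [mem_engel_iff]
  exact ⟨k, by rw [← key, h]; rfl⟩

variable [FiniteDimensional ℂ L]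

lemma isRegular_lieEquiv_iff (σ : L ≃ₗ⁅ℂ⁆ L) (x : L) :
    IsRegular ℂ (σ x) ↔ IsRegular ℂ x := by
  simp only [isRegular_iff_finrank_engel_eq_rank, finrank_engel_lieEquiv]

/-- The Engel subalgebra of a regular element has the least possible dimension, the rank. It is
therefore contained in the Engel subalgebra of each of its own elements, which makes it nilpotent.
-/
lemma isCartanSubalgebra_engel_of_isRegular {x : L} (hx : IsRegular ℂ x) :
    (engel ℂ x).IsCartanSubalgebra := by
  refine ⟨?_, normalizer_engel _ _⟩
  apply isNilpotent_of_forall_le_engel (R := ℂ)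
  intro y hy
  set Ex : {engel ℂ z | z ∈ engel ℂ x} := ⟨engel ℂ x, x, self_mem_engel _ _, rfl⟩
  suffices IsBot Ex from @this ⟨engel ℂ y, y, hy, rfl⟩
  refine engel_isBot_of_isMin ?_ (engel ℂ x) Ex le_rfl ?_
  · exact Cardinal.natCast_le_aleph0.trans (Cardinal.infinite_iff.mp inferInstance)
  rintro ⟨_, y, hy, rfl⟩ hyx
  suffices finrank ℂ (engel ℂ x) ≤ finrank ℂ (engel ℂ y) by
    suffices engel ℂ y = engel ℂ x from this.ge
    apply LieSubalgebra.toSubmodule_injective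
    exact Submodule.eq_of_le_of_finrank_le hyx this
  rw [(isRegular_iff_finrank_engel_eq_rank ℂ x).mp hx]
  apply rank_le_finrank_engel

/-- `H` lies in `engel ℂ r`, whose dimension is the rank, while `H` as an Engel subalgebra has at
least that dimension. -/
lemma engel_eq_of_isRegular (H : LieSubalgebra ℂ L) [H.IsCartanSubalgebra] {x r : L}
    (hx : engel ℂ x = H) (hr : r ∈ H) (hreg : IsRegular ℂ r) : engel ℂ r = H := by
  symm
  apply LieSubalgebra.toSubmodule_injective
  refine Submodule.eq_of_le_of_finrank_le (le_engel_of_isCartanSubalgebra H hr) ?_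
  have h1 := (isRegular_iff_finrank_engel_eq_rank ℂ r).mp hreg
  have h2 := rank_le_finrank_engel ℂ x
  rw [hx] at h2
  exact h1.trans_le h2

/-- Fitting decomposition of `ad x`, in the form of surjectivity of the tangent map of `(y, k) ↦ exp
(ad y) (x + k)`. The exponent `n + 1` makes the range part a bracket with `x`. -/
lemma exists_lie_add_mem_engel (x z : L) : ∃ y : L, ∃ k ∈ engel ℂ x, z = ⁅y, x⁆ + k := by
  obtain ⟨n, hn⟩ := Filter.eventually_atTop.mp (ad ℂ L x).eventually_isCompl_ker_pow_range_pow
  have h := (hn (n + 1) (by lia)).sup_eq_top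
  obtain ⟨k, hk, w, ⟨u, rfl⟩, rfl⟩ := Submodule.mem_sup.mp (h ▸ Submodule.mem_top (x := z))
  refine ⟨-((ad ℂ L x) ^ n) u, k, (mem_engel_iff ℂ x k).mpr ⟨n + 1, hk⟩, ?_⟩
  rw [neg_lie, lie_skew, pow_succ', add_comm]
  rfl

lemma eventually_exists_lieEquiv_engel (x v : L) :
    ∀ᶠ t : ℂ in nhds 0, ∃ σ : L ≃ₗ⁅ℂ⁆ L, ∃ r ∈ engel ℂ x, x + t • v = σ r := by
  have h := eventually_exists_isExpAd ⊤ (engel ℂ x).toSubmodule x (fun z => by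
    obtain ⟨y, k, hk, hz⟩ := exists_lie_add_mem_engel x z
    exact ⟨y, Submodule.mem_top, k, hk, hz⟩) v
  filter_upwards [h] with t ⟨y, _, σ, _, k, hk, e⟩
  exact ⟨σ, x + k, add_mem (self_mem_engel ℂ x) hk, e⟩

/-- Regularity is the nonvanishing of one coefficient of the characteristic polynomial of `ad`; on a
line this is a polynomial in `t`, not zero at `t₀`. -/
lemma finite_setOf_not_isRegular (x v : L) (t₀ : ℂ) (h : IsRegular ℂ (x + t₀ • v)) :
    {t : ℂ | ¬ IsRegular ℂ (x + t • v)}.Finite := by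
  classical
  let b := Module.Free.chooseBasis ℂ L
  let q := (LinearMap.polyCharpoly (ad ℂ L : L →ₗ[ℂ] Module.End ℂ L) b).coeff (rank ℂ L)
  let p : Polynomial ℂ := MvPolynomial.aeval
    (fun i => Polynomial.C (b.repr v i) * Polynomial.X + Polynomial.C (b.repr x i)) q
  have hp (t : ℂ) : p.eval t = MvPolynomial.eval (b.repr (x + t • v)) q := by
    rw [← Polynomial.coe_aeval_eq_eval]
    simp only [p]
    rw [← AlgHom.comp_apply, MvPolynomial.comp_aeval, ← MvPolynomial.coe_aeval_eq_eval]
    have h1 : (fun i => Polynomial.aeval t (Polynomial.C (b.repr v i) * Polynomial.X +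
        Polynomial.C (b.repr x i))) = b.repr (x + t • v) := by
      ext i
      simp [mul_comm t, add_comm]
    rw [h1]
    rfl
  have hreg (t : ℂ) : IsRegular ℂ (x + t • v) ↔ p.eval t ≠ 0 := by
    rw [hp]
    exact isRegular_iff_coeff_polyCharpoly_rank_ne_zero ℂ b (x + t • v)
  have hp0 : p ≠ 0 := by
    rintro h0
    exact (hreg t₀).mp h (by simp [h0])
  refine (p.roots.toFinset.finite_toSet).subset fun t ht => ?_
  have : p.eval t = 0 := by
    by_contra h1
    exact ht ((hreg t).mpr h1)
  simp [hp0, this]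

/-- Any two Engel subalgebras of regular elements are conjugate. -/
lemma exists_lieEquiv_engel_of_isRegular {x y : L} (hx : IsRegular ℂ x) (hy : IsRegular ℂ y) :
    ∃ σ : L ≃ₗ⁅ℂ⁆ L, ∀ z, z ∈ engel ℂ x ↔ σ z ∈ engel ℂ y := by
  let p (t : ℂ) : L := x + t • (y - x)
  have hS : {t : ℂ | ¬ IsRegular ℂ (p t)}.Countable :=
    (finite_setOf_not_isRegular x (y - x) 0 (by simpa using hx)).countable
  have := rel_of_eventually_rel hS
    (fun s t => ∃ σ : L ≃ₗ⁅ℂ⁆ L, ∀ z, z ∈ engel ℂ (p s) ↔ σ z ∈ engel ℂ (p t))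
    (fun s t ⟨σ, h⟩ => ⟨σ.symm, fun z => by simpa using (h (σ.symm z)).symm⟩)
    (fun s t u ⟨σ, h⟩ ⟨τ, h'⟩ => ⟨σ.trans τ, fun z => (h z).trans (h' (σ z))⟩)
    -- Near a regular `p s` one has `p t = σ r` with `r` in the Cartan subalgebra `engel ℂ (p s)`.
    -- If `p t` is regular, so is `r`, hence `engel ℂ r` is that same subalgebra and `σ` carries it
    -- to `engel ℂ (p t)`.
    (fun s hs => by
      have hs' : IsRegular ℂ (p s) := by simpa using hs
      have hC := isCartanSubalgebra_engel_of_isRegular hs'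
      have h1 := eventually_exists_lieEquiv_engel (p s) (y - x)
      have h2 : Filter.Tendsto (fun t : ℂ => t - s) (nhds s) (nhds 0) := by
        have : Continuous (fun t : ℂ => t - s) := by fun_prop
        simpa using this.tendsto s
      filter_upwards [h2.eventually h1] with t ⟨σ, r, hr, e⟩ ht
      have e' : p t = σ r := by
        rw [← e]; simp only [p]; module
      have ht' : IsRegular ℂ (p t) := by simpa using ht
      have hr' : IsRegular ℂ r := by rwa [e', isRegular_lieEquiv_iff] at ht'
      refine ⟨σ, fun z => ?_⟩
      rw [e', lieEquiv_mem_engel_iff, engel_eq_of_isRegular (engel ℂ (p s)) rfl hr hr'])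
    (x := 0) (y := 1) (by simpa [p] using hx) (by simpa [p] using hy)
  simpa [p] using this

/-- The given `x` is not known to be regular. On the line towards a regular element, the points near
`x` and distinct from it are regular and conjugate to elements of `engel ℂ x = H`. -/
lemma exists_isRegular_engel_eq (H : LieSubalgebra ℂ L) [H.IsCartanSubalgebra] {x : L}
    (hx : engel ℂ x = H) : ∃ r, IsRegular ℂ r ∧ engel ℂ r = H := by
  obtain ⟨y, hy⟩ := exists_isRegular ℂ L
  have hfin := finite_setOf_not_isRegular x (y - x) 1 (by simpa using hy)
  have h1 := eventually_exists_lieEquiv_engel x (y - x)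
  have h2 : ∀ᶠ t : ℂ in nhdsWithin 0 {0}ᶜ, IsRegular ℂ (x + t • (y - x)) := by
    have h3 : ∀ᶠ t : ℂ in nhdsWithin 0 {0}ᶜ,
        t ∉ {t : ℂ | ¬ IsRegular ℂ (x + t • (y - x))} \ {0} := by
      have : IsClosed ({t : ℂ | ¬ IsRegular ℂ (x + t • (y - x))} \ {0}) :=
        (hfin.subset Set.sdiff_subset).isClosed
      exact nhdsWithin_le_nhds (this.isOpen_compl.mem_nhds (by simp))
    filter_upwards [h3, self_mem_nhdsWithin] with t ht ht0
    by_contra hc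
    exact ht ⟨hc, ht0⟩
  obtain ⟨t, ⟨σ, r, hr, e⟩, ht⟩ := ((h1.filter_mono nhdsWithin_le_nhds).and h2).exists
  rw [e, isRegular_lieEquiv_iff] at ht
  exact ⟨r, ht, engel_eq_of_isRegular H hx (hx ▸ hr) ht⟩

section Killing

variable [LieAlgebra.IsKilling ℂ L]

lemma exists_engel_eq_of_isCartanSubalgebra (H : LieSubalgebra ℂ L) [H.IsCartanSubalgebra] :
    ∃ x, engel ℂ x = H := by
  -- An element `x` off the finitely many root hyperplanes acts bijectively on the sum `N` of the
  -- root spaces, so its generalised null space is `H` alone.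
  obtain ⟨x, hx⟩ := Module.Dual.exists_forall_ne_zero_of_forall_exists
    (fun α : H.root => (α : LieModule.Weight ℂ H L).toLinear) (fun α => by
      refine ⟨coroot α, ?_⟩
      have := root_apply_coroot (K := ℂ) (LieSubalgebra.isNonZero_coe_root α)
      exact ne_of_eq_of_ne this two_ne_zero)
  refine ⟨x, ?_⟩
  let N : Submodule ℂ L := ⨆ α : H.root, (rootSpace H (α : LieModule.Weight ℂ H L)).toSubmodule
  have hmap (α : H.root) : ∀ z ∈ (rootSpace H (α : LieModule.Weight ℂ H L)).toSubmodule,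
      ⁅(x : L), z⁆ = (α : LieModule.Weight ℂ H L) x • z := fun z hz =>
    lie_eq_smul_of_mem_rootSpace hz x
  have hN1 : ∀ z ∈ N, ad ℂ L x z ∈ N := by
    intro z hz
    change z ∈ N.comap (ad ℂ L x)
    revert z
    change N ≤ _
    refine iSup_le fun α z hz => ?_
    have : ad ℂ L x z ∈ (rootSpace H (α : LieModule.Weight ℂ H L)).toSubmodule := by
      rw [ad_apply, hmap α z hz]; exact Submodule.smul_mem _ _ hz
    exact Submodule.mem_iSup_of_mem α this
  have hN2 : N ≤ N.map (ad ℂ L x) := by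
    refine iSup_le fun α z hz => ?_
    refine ⟨((α : LieModule.Weight ℂ H L) x)⁻¹ • z,
      Submodule.mem_iSup_of_mem α (Submodule.smul_mem _ _ hz), ?_⟩
    rw [map_smul, ad_apply, hmap α z hz, smul_smul, inv_mul_cancel₀, one_smul]
    exact hx α
  have hinj : Function.Injective ((ad ℂ L x).restrict hN1) := by
    rw [LinearMap.injective_iff_surjective]
    rintro ⟨z, hz⟩
    obtain ⟨w, hw, e⟩ := hN2 hz
    exact ⟨⟨w, hw⟩, Subtype.ext e⟩
  have htop (z : L) : ∃ h ∈ H, ∃ n ∈ N, z = h + n := by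
    have h1 : z ∈ H.toSubmodule ⊔ N := by
      have h2 : (⊤ : Submodule ℂ L) ≤ H.toSubmodule ⊔ N := by
        have h3 := congrArg LieSubmodule.toSubmodule (LieModule.iSup_genWeightSpace_eq_top' ℂ H L)
        rw [LieSubmodule.iSup_toSubmodule, LieSubmodule.top_toSubmodule] at h3
        rw [← h3]
        refine iSup_le fun α => ?_
        by_cases hα : α.IsZero
        · refine le_sup_of_le_left fun z hz => ?_
          have h4 : z ∈ rootSpace H (0 : H → ℂ) := by rw [← hα.eq]; exact hz
          rwa [rootSpace_zero_eq, LieSubalgebra.mem_toLieSubmodule] at h4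
        · exact le_sup_of_le_right (le_iSup (fun α : H.root =>
            (rootSpace H (α : LieModule.Weight ℂ H L)).toSubmodule) ⟨α, by simpa using hα⟩)
      exact h2 Submodule.mem_top
    obtain ⟨h, hh, n, hn, e⟩ := Submodule.mem_sup.mp h1
    exact ⟨h, hh, n, hn, e.symm⟩
  refine le_antisymm (fun z hz => ?_) (le_engel_of_isCartanSubalgebra H x.2)
  have hz' : ⁅(x : L), z⁆ = 0 := by
    have hss := isSemisimple_ad_of_mem_isCartanSubalgebra (K := ℂ) (H := H) x.2
    have h1 : z ∈ (ad ℂ L x).maxGenEigenspace 0 := hz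
    rw [hss.isFinitelySemisimple.maxGenEigenspace_eq_eigenspace,
      Module.End.mem_eigenspace_iff] at h1
    simpa using h1
  obtain ⟨h, hh, n, hn, rfl⟩ := htop z
  have h0 : ⁅(x : L), h⁆ = 0 := by
    have := congrArg (Subtype.val) (trivial_lie_zero H H x ⟨h, hh⟩)
    simpa using this
  rw [lie_add, h0, zero_add] at hz'
  have h5 : (⟨n, hn⟩ : N) = 0 := hinj (by
    rw [map_zero]; exact Subtype.ext hz')
  have : n = 0 := congrArg Subtype.val h5
  simpa [this] using hh

/-- Cartan subalgebras of a complex Lie algebra with nondegenerate Killing form are conjugate. -/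
theorem exists_lieEquiv_isCartanSubalgebra (H H' : LieSubalgebra ℂ L) [H.IsCartanSubalgebra]
    [H'.IsCartanSubalgebra] : ∃ σ : L ≃ₗ⁅ℂ⁆ L, ∀ z, z ∈ H ↔ σ z ∈ H' := by
  obtain ⟨x, hx⟩ := exists_engel_eq_of_isCartanSubalgebra H
  obtain ⟨y, hy⟩ := exists_engel_eq_of_isCartanSubalgebra H'
  obtain ⟨r, hr, rfl⟩ := exists_isRegular_engel_eq H hx
  obtain ⟨s, hs, rfl⟩ := exists_isRegular_engel_eq H' hy
  exact exists_lieEquiv_engel_of_isRegular hr hs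

end Killing

/-- An element whose adjoint action has no generalised zero eigenvectors besides the
eigenvectors lies in a Cartan subalgebra. -/
lemma exists_isCartanSubalgebra_mem (h : L) (hss : ∀ x : L, ⁅h, ⁅h, x⁆⁆ = 0 → ⁅h, x⁆ = 0) :
    ∃ H : LieSubalgebra ℂ L, H.IsCartanSubalgebra ∧ h ∈ H := by
  -- A Cartan subalgebra `K` of the centraliser `C` of `h` is one of `L`: being central in `C`, `h`
  -- lies in `K`; and if `y` normalises `K` in `L`, then `⁅y, h⁆` commutes with `h`, so `y` lies in
  -- `C` by `hss`.
  let C : LieSubalgebra ℂ L :=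
    { LinearMap.ker (ad ℂ L h) with
      lie_mem' := by
        intro x y hx hy
        have hx' : ⁅h, x⁆ = 0 := hx
        have hy' : ⁅h, y⁆ = 0 := hy
        change ⁅h, ⁅x, y⁆⁆ = 0
        rw [leibniz_lie, hx', hy', zero_lie, lie_zero, add_zero] }
  have hC (x : L) : x ∈ C ↔ ⁅h, x⁆ = 0 := Iff.rfl
  obtain ⟨x, hx⟩ := exists_isCartanSubalgebra_engel ℂ C
  let K : LieSubalgebra ℂ C := engel ℂ x
  have hK : K.IsCartanSubalgebra := hx
  have hKmem (y : C) (hy : ∀ z ∈ K, ⁅y, z⁆ ∈ K) : y ∈ K := by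
    have : y ∈ K.normalizer := (K.mem_normalizer_iff y).mpr hy
    rwa [LieSubalgebra.IsCartanSubalgebra.self_normalizing] at this
  let f : K →ₗ⁅ℂ⁆ L := C.incl.comp K.incl
  have hf : Function.Injective f := Subtype.val_injective.comp Subtype.val_injective
  have hrange (y : L) : y ∈ f.range ↔ ∃ hy : y ∈ C, (⟨y, hy⟩ : C) ∈ K := by
    rw [LieHom.mem_range]
    constructor
    · rintro ⟨z, rfl⟩; exact ⟨z.1.2, z.2⟩
    · rintro ⟨hy, hy'⟩; exact ⟨⟨⟨y, hy⟩, hy'⟩, rfl⟩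
  have hh : h ∈ f.range := (hrange h).mpr ⟨by simp [hC], hKmem _ fun z _ => by
    have : ⁅(⟨h, by simp [hC]⟩ : C), z⁆ = 0 := Subtype.ext ((hC z).mp z.2)
    rw [this]; exact K.zero_mem⟩
  refine ⟨f.range, ⟨?_, ?_⟩, hh⟩
  · exact (LieEquiv.ofInjective f hf).nilpotent_iff_equiv_nilpotent.mp hK.nilpotent
  · refine le_antisymm (fun y hy => ?_) (LieSubalgebra.le_normalizer _)
    rw [LieSubalgebra.mem_normalizer_iff] at hy
    have h1 : ⁅h, y⁆ = 0 := by
      obtain ⟨h2, -⟩ := (hrange _).mp (hy h hh)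
      have h3 : ⁅y, h⁆ = -⁅h, y⁆ := (lie_skew _ _).symm
      rw [hC, h3, lie_neg, neg_eq_zero] at h2
      exact hss y h2
    refine (hrange y).mpr ⟨h1, hKmem _ fun z hz => ?_⟩
    obtain ⟨h2, h3⟩ := (hrange _).mp (hy z ((hrange z).mpr ⟨z.2, hz⟩))
    exact h3

end CartanConjugacy

/-! ### Finite-dimensional modules of `sl₂`: integrality and semisimplicity of `h`. -/

section SlTwoModules

open LieModule Module

variable {L M : Type*} [LieRing L] [LieAlgebra ℂ L] [AddCommGroup M] [Module ℂ M]
  [LieRingModule L M] [LieModule ℂ L M] [FiniteDimensional ℂ M] {h e f : L}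

lemma finite_setOf_lie_eq_smul (h : L) : {μ : ℂ | ∃ m : M, m ≠ 0 ∧ ⁅h, m⁆ = μ • m}.Finite := by
  refine (Module.End.finite_hasEigenvalue (toEnd ℂ L M h)).subset ?_
  rintro μ ⟨m, hm, hm'⟩
  exact Module.End.hasEigenvalue_of_hasEigenvector
    ⟨Module.End.mem_eigenspace_iff.mpr hm', hm⟩

lemma exists_pow_toEnd_e_eq_zero (t : IsSl2Triple h e f) {m : M} {μ : ℂ} (hm : ⁅h, m⁆ = μ • m) :
    ∃ n : ℕ, (toEnd ℂ L M e ^ n) m = 0 := by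
  by_contra! hc
  refine (Set.infinite_range_of_injective (f := fun n : ℕ => μ + 2 * (n : ℂ)) ?_)
    ((finite_setOf_lie_eq_smul (M := M) h).subset ?_)
  · intro a b hab
    simpa using hab
  · rintro _ ⟨n, rfl⟩
    exact ⟨_, hc n, t.lie_h_pow_toEnd_e hm n⟩

lemma exists_top_pow_toEnd_e (t : IsSl2Triple h e f) {m : M} {μ : ℂ} (hm : ⁅h, m⁆ = μ • m)
    (hm0 : m ≠ 0) : ∃ n : ℕ, (toEnd ℂ L M e ^ n) m ≠ 0 ∧ (toEnd ℂ L M e ^ (n + 1)) m = 0 :=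
  Nat.exists_not_and_succ_of_not_zero_of_exists hm0 (exists_pow_toEnd_e_eq_zero t hm)

/-- The eigenvalues of `h` on a finite-dimensional module are integers. -/
lemma exists_int_of_lie_h_eq_smul (t : IsSl2Triple h e f) {m : M} {μ : ℂ} (hm : ⁅h, m⁆ = μ • m)
    (hm0 : m ≠ 0) : ∃ z : ℤ, μ = z := by
  obtain ⟨n, hn, hn'⟩ := exists_top_pow_toEnd_e t hm hm0
  have P : t.HasPrimitiveVectorWith ((toEnd ℂ L M e ^ n) m) (μ + 2 * n) :=
    ⟨hn, t.lie_h_pow_toEnd_e hm n, by rw [IsSl2Triple.lie_e_pow_toEnd_e, hn']⟩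
  obtain ⟨k, hk⟩ := P.exists_nat
  exact ⟨k - 2 * n, by push_cast; linear_combination hk⟩

/-- On the eigenspaces of `h` for positive integers, the operator `e f` is injective. -/
lemma eq_zero_of_lie_e_lie_f (t : IsSl2Triple h e f) {w : M} {k : ℕ} (hk : 0 < k)
    (hw : ⁅h, w⁆ = (k : ℂ) • w) (hefw : ⁅e, ⁅f, w⁆⁆ = 0) : w = 0 := by
  by_contra hw0
  -- If `e f w = 0`, then `f` lowers the string `e ^ j w` with coefficients that never vanish for `k
  -- > 0`; so the string could not terminate.
  have key (j : ℕ) : ⁅f, (toEnd ℂ L M e ^ (j + 1)) w⁆ =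
      (-((j + 1) * (k + j)) : ℂ) • (toEnd ℂ L M e ^ j) w := by
    have hfe (m : M) : ⁅f, ⁅e, m⁆⁆ = ⁅e, ⁅f, m⁆⁆ - ⁅h, m⁆ := by
      rw [← t.lie_e_f, lie_lie]; abel
    induction j with
    | zero => simp [hfe, hefw, hw]
    | succ j ih =>
      rw [← IsSl2Triple.lie_e_pow_toEnd_e, hfe, ih, lie_smul, IsSl2Triple.lie_e_pow_toEnd_e,
        t.lie_h_pow_toEnd_e hw, ← sub_smul]
      congr 1
      push_cast
      ring
  obtain ⟨n, hn, hn'⟩ := exists_top_pow_toEnd_e t hw hw0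
  have h1 := key n
  rw [hn', lie_zero, eq_comm, smul_eq_zero_iff_left hn] at h1
  have h2 : ((n + 1) * (k + n) : ℕ) = (0 : ℂ) := by
    push_cast
    linear_combination -h1
  have h3 := Nat.cast_eq_zero.mp h2
  simp at h3
  lia

/-- On the eigenspaces of `h` for positive integers, the operator `e f` is surjective. -/
lemma exists_lie_e_lie_f_eq (t : IsSl2Triple h e f) {v : M} {k : ℕ} (hk : 0 < k)
    (hv : ⁅h, v⁆ = (k : ℂ) • v) : ∃ w : M, ⁅h, w⁆ = (k : ℂ) • w ∧ ⁅e, ⁅f, w⁆⁆ = v := by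
  let V := Module.End.eigenspace (toEnd ℂ L M h) (k : ℂ)
  have hV (w : M) : w ∈ V ↔ ⁅h, w⁆ = (k : ℂ) • w := Module.End.mem_eigenspace_iff
  let T : Module.End ℂ M := toEnd ℂ L M e * toEnd ℂ L M f
  have hT (w : M) : T w = ⁅e, ⁅f, w⁆⁆ := rfl
  have hTV : ∀ w ∈ V, T w ∈ V := by
    intro w hw
    rw [hV] at hw ⊢
    rw [hT, leibniz_lie, leibniz_lie h f, hw, t.lie_lie_smul_f ℂ, t.lie_h_e_smul ℂ]
    simp only [smul_lie, neg_lie, lie_add, lie_neg, lie_smul]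
    module
  have hinj : Function.Injective (T.restrict hTV) := by
    rw [← LinearMap.ker_eq_bot, LinearMap.ker_eq_bot']
    rintro ⟨w, hw⟩ hw0
    exact Subtype.ext (eq_zero_of_lie_e_lie_f t hk ((hV w).mp hw) (congrArg Subtype.val hw0))
  obtain ⟨⟨w, hw⟩, e⟩ := LinearMap.injective_iff_surjective.mp hinj ⟨v, (hV v).mpr hv⟩
  exact ⟨w, (hV w).mp hw, congrArg Subtype.val e⟩

/-- No Jordan block of `h` on vectors killed by `e`. If `u ≠ 0`, its weight is some `n : ℕ`, and `e
(f ^ (n + 1) v) = (n + 1) • f ^ n u ≠ 0`. Beyond that point the terms in `u` vanish and the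
coefficients `(k + 1) (n - k)` do not, so no `f ^ k v` is zero; but `f ^ (n + 1) v` is an
eigenvector of `h`, on which `f` acts nilpotently. -/
lemma eq_zero_of_lie_h_eq_smul_add (t : IsSl2Triple h e f) {v u : M} {z : ℂ} (hev : ⁅e, v⁆ = 0)
    (hhv : ⁅h, v⁆ = z • v + u) (heu : ⁅e, u⁆ = 0) (hhu : ⁅h, u⁆ = z • u) : u = 0 := by
  by_contra hu0
  have P : t.HasPrimitiveVectorWith u z := ⟨hu0, hhu, heu⟩
  obtain ⟨n, rfl⟩ := P.exists_nat
  have hh (k : ℕ) : ⁅h, (toEnd ℂ L M f ^ k) v⁆ =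
      ((n : ℂ) - 2 * k) • (toEnd ℂ L M f ^ k) v + (toEnd ℂ L M f ^ k) u := by
    induction k with
    | zero => simpa using hhv
    | succ k ih =>
      rw [pow_succ', Module.End.mul_apply, Module.End.mul_apply, toEnd_apply_apply,
        toEnd_apply_apply, leibniz_lie, ih, t.lie_lie_smul_f ℂ]
      simp only [smul_lie, neg_lie, lie_add, lie_smul]
      push_cast
      module
  have he (k : ℕ) : ⁅e, (toEnd ℂ L M f ^ (k + 1)) v⁆ =
      ((k + 1) * ((n : ℂ) - k)) • (toEnd ℂ L M f ^ k) v + ((k : ℂ) + 1) • (toEnd ℂ L M f ^ k) u := by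
    induction k with
    | zero => simp [leibniz_lie e, t.lie_e_f, hev, hhv]
    | succ k ih =>
      rw [pow_succ', Module.End.mul_apply, toEnd_apply_apply, leibniz_lie e, t.lie_e_f, ih, hh]
      simp only [lie_add, lie_smul]
      simp only [pow_succ' _ k, Module.End.mul_apply, toEnd_apply_apply]
      push_cast
      module
  have hne (k : ℕ) : (toEnd ℂ L M f ^ (n + 1 + k)) v ≠ 0 ∧ (toEnd ℂ L M f ^ (n + 1 + k)) u = 0 := by
    induction k with
    | zero =>
      refine ⟨fun h0 => ?_, P.pow_toEnd_f_eq_zero_of_eq_nat rfl⟩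
      have h1 := he n
      simp only [add_zero] at h0
      rw [h0] at h1
      simp only [lie_zero, sub_self, mul_zero, zero_smul, zero_add] at h1
      rw [eq_comm, smul_eq_zero_iff_left (P.pow_toEnd_f_ne_zero_of_eq_nat rfl le_rfl)] at h1
      exact Nat.cast_add_one_ne_zero n h1
    | succ k ih =>
      refine ⟨fun h0 => ?_, ?_⟩
      · have h1 := he (n + 1 + k)
        rw [ih.2, smul_zero, add_zero, add_assoc _ k, h0, lie_zero, eq_comm,
          smul_eq_zero_iff_left ih.1] at h1
        push_cast at h1
        rcases mul_eq_zero.mp h1 with h2 | h2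
        · have : ((n + 1 + k + 1 : ℕ) : ℂ) = 0 := by push_cast; exact h2
          exact absurd (Nat.cast_eq_zero.mp this) (by lia)
        · have : ((k + 1 : ℕ) : ℂ) = 0 := by push_cast; linear_combination -h2
          exact absurd (Nat.cast_eq_zero.mp this) (by lia)
      · rw [← add_assoc, pow_succ', Module.End.mul_apply, ih.2, map_zero]
  have h1 := hh (n + 1)
  rw [(hne 0).2, add_zero] at h1
  have h1' : ⁅-h, (toEnd ℂ L M f ^ (n + 1)) v⁆ =
      (-((n : ℂ) - 2 * (n + 1 : ℕ))) • (toEnd ℂ L M f ^ (n + 1)) v := by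
    rw [neg_lie, h1, neg_smul]
  obtain ⟨k, hk⟩ := exists_pow_toEnd_e_eq_zero t.symm h1'
  rw [← Module.End.mul_apply, ← pow_add, add_comm] at hk
  exact (hne k).1 hk

/-- On a finite-dimensional module, the generalised eigenvectors of `h` are eigenvectors. -/
lemma lie_h_eq_smul_of_lie_lie (t : IsSl2Triple h e f) {μ : ℂ} {w : M}
    (hw : ⁅h, ⁅h, w⁆ - μ • w⁆ = μ • (⁅h, w⁆ - μ • w)) : ⁅h, w⁆ = μ • w := by
  by_contra hc
  -- A Jordan block at `μ` forces one at `μ + 2`, hence infinitely many eigenvalues. Otherwise `e w`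
  -- is an eigenvector or zero and `e u = 0`; subtracting `f w'` with `e f w' = e w` turns `w` into
  -- a vector killed by `e`, against `eq_zero_of_lie_h_eq_smul_add`.
  have hstep (μ : ℂ) : (∃ w : M, ⁅h, ⁅h, w⁆ - μ • w⁆ = μ • (⁅h, w⁆ - μ • w) ∧ ⁅h, w⁆ ≠ μ • w) →
      ∃ w : M, ⁅h, ⁅h, w⁆ - (μ + 2) • w⁆ = (μ + 2) • (⁅h, w⁆ - (μ + 2) • w) ∧
        ⁅h, w⁆ ≠ (μ + 2) • w := by
    rintro ⟨w, hw, hw'⟩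
    by_contra! hall
    have hu0 : ⁅h, w⁆ - μ • w ≠ 0 := sub_ne_zero.mpr hw'
    set u := ⁅h, w⁆ - μ • w with hu
    have hhe (m : M) : ⁅h, ⁅e, m⁆⁆ = ⁅e, ⁅h, m⁆⁆ + (2 : ℂ) • ⁅e, m⁆ := by
      rw [leibniz_lie, t.lie_h_e_smul ℂ, smul_lie, add_comm]
    have hhw : ⁅h, w⁆ = μ • w + u := by rw [hu]; abel
    have h1 : ⁅h, ⁅e, w⁆⁆ - (μ + 2) • ⁅e, w⁆ = ⁅e, u⁆ := by
      rw [hhe, hhw, lie_add, lie_smul]; module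
    have h2 := hall ⁅e, w⁆ (by rw [h1, hhe, hw, lie_smul]; module)
    have heu : ⁅e, u⁆ = 0 := by rw [← h1, h2, sub_self]
    obtain ⟨n, rfl⟩ := (⟨hu0, hw, heu⟩ : t.HasPrimitiveVectorWith u μ).exists_nat
    obtain ⟨w', hw', hefw'⟩ := exists_lie_e_lie_f_eq t (v := ⁅e, w⁆) (k := n + 2) (by lia)
      (by push_cast; exact h2)
    refine hu0 (eq_zero_of_lie_h_eq_smul_add t (v := w - ⁅f, w'⁆) (z := n) ?_ ?_ heu hw)
    · rw [lie_sub, hefw', sub_self]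
    · rw [lie_sub, leibniz_lie h f, hw', t.lie_lie_smul_f ℂ, hhw]
      simp only [neg_lie, smul_lie, lie_smul]
      push_cast
      module
  have hall (n : ℕ) : ∃ w : M, ⁅h, ⁅h, w⁆ - (μ + 2 * n) • w⁆ = (μ + 2 * n) • (⁅h, w⁆ - (μ + 2 * n) • w)
      ∧ ⁅h, w⁆ ≠ (μ + 2 * n) • w := by
    induction n with
    | zero => exact ⟨w, by simpa using hw, by simpa using hc⟩
    | succ n ih =>
      have := hstep _ ih
      have e : μ + 2 * ((n + 1 : ℕ) : ℂ) = μ + 2 * n + 2 := by push_cast; ring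
      rwa [e]
  refine (Set.infinite_range_of_injective (f := fun n : ℕ => μ + 2 * (n : ℂ)) ?_)
    ((finite_setOf_lie_eq_smul (M := M) h).subset ?_)
  · intro a b hab
    simpa using hab
  · rintro _ ⟨n, rfl⟩
    obtain ⟨w, h1, h2⟩ := hall n
    exact ⟨_, sub_ne_zero.mpr h2, h1⟩

end SlTwoModules

section Adjoint

variable {L : Type*} [LieRing L] [LieAlgebra ℂ L] [FiniteDimensional ℂ L] {h e f : L}

lemma _root_.IsSl2Triple.exists_isCartanSubalgebra (t : IsSl2Triple h e f) :
    ∃ H : LieSubalgebra ℂ L, H.IsCartanSubalgebra ∧ h ∈ H :=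
  exists_isCartanSubalgebra_mem h fun x hx => by
    simpa using lie_h_eq_smul_of_lie_lie t (μ := 0) (w := x) (by simpa using hx)

/-- `ad e` maps the centraliser of `h` onto the eigenspace of `h` for the eigenvalue `2`. -/
lemma exists_lie_e_eq_of_lie_h_eq (t : IsSl2Triple h e f) {v : L} (hv : ⁅h, v⁆ = (2 : ℂ) • v) :
    ∃ y : L, ⁅h, y⁆ = 0 ∧ ⁅e, y⁆ = v := by
  obtain ⟨w, hw, hw'⟩ := exists_lie_e_lie_f_eq t (k := 2) (by lia) (by exact_mod_cast hv)
  refine ⟨⁅f, w⁆, ?_, hw'⟩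
  rw [leibniz_lie, hw, t.lie_lie_smul_f ℂ]
  simp

end Adjoint

/-! ### Conjugacy of `sl₂`-triples with the same neutral element. -/

section TripleConjugacy

open Module

variable {L : Type*} [LieRing L] [LieAlgebra ℂ L]

/-- The eigenspace of `ad h` for the eigenvalue `μ`. -/
def adEigenspace (h : L) (μ : ℂ) : Submodule ℂ L := Module.End.eigenspace (ad ℂ L h) μ

lemma mem_adEigenspace {h : L} {μ : ℂ} {x : L} : x ∈ adEigenspace h μ ↔ ⁅h, x⁆ = μ • x :=
  Module.End.mem_eigenspace_iff

lemma lie_mem_adEigenspace {h y x : L} {μ ν : ℂ} (hy : y ∈ adEigenspace h μ)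
    (hx : x ∈ adEigenspace h ν) : ⁅y, x⁆ ∈ adEigenspace h (μ + ν) := by
  rw [mem_adEigenspace] at *
  rw [leibniz_lie, hy, hx, smul_lie, lie_smul, ← add_smul]

variable [FiniteDimensional ℂ L]

/-- With `s` a right inverse of `ad x` from the `0`- to the `2`-eigenspace, `ad (x + t v) ∘ s = 1 +
t N`, which is invertible unless `-1 / t` is an eigenvalue of `N`. -/
lemma finite_setOf_not_surjective_lie (h x v : L) (hx : x ∈ adEigenspace h 2)
    (hv : v ∈ adEigenspace h 2)
    (hgood : ∀ z ∈ adEigenspace h 2, ∃ y ∈ adEigenspace h 0, ⁅x, y⁆ = z) :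
    {t : ℂ | ¬ ∀ z ∈ adEigenspace h 2, ∃ y ∈ adEigenspace h 0, ⁅x + t • v, y⁆ = z}.Finite := by
  have hmaps {x : L} (hx : x ∈ adEigenspace h 2) :
      ∀ y ∈ adEigenspace h 0, ad ℂ L x y ∈ adEigenspace h 2 := fun y hy => by
    simpa using lie_mem_adEigenspace hx hy
  let A := (ad ℂ L x).restrict (hmaps hx)
  let B := (ad ℂ L v).restrict (hmaps hv)
  have hA : Function.Surjective A := by
    rintro ⟨z, hz⟩
    obtain ⟨y, hy, e⟩ := hgood z hz
    exact ⟨⟨y, hy⟩, Subtype.ext e⟩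
  obtain ⟨s, hs⟩ := A.exists_rightInverse_of_surjective (LinearMap.range_eq_top.mpr hA)
  let N : Module.End ℂ (adEigenspace h 2) := B ∘ₗ s
  refine ((Module.End.finite_hasEigenvalue N).image fun μ => -μ⁻¹).subset fun t ht => ?_
  by_contra hc
  refine ht fun z hz => ?_
  have hinj : Function.Injective (1 + t • N : Module.End ℂ (adEigenspace h 2)) := by
    rw [← LinearMap.ker_eq_bot, LinearMap.ker_eq_bot']
    intro w hw
    by_contra hw0
    have hw' : w + t • N w = 0 := hw
    have ht0 : t ≠ 0 := by
      rintro rfl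
      exact hw0 (by simpa using hw')
    refine hc ⟨-t⁻¹, ?_, by simp⟩
    refine Module.End.hasEigenvalue_of_hasEigenvector (x := w)
      ⟨Module.End.mem_eigenspace_iff.mpr ?_, hw0⟩
    have : t • N w = -w := by rw [eq_neg_iff_add_eq_zero, add_comm, hw']
    rw [neg_smul, ← smul_neg, ← this, smul_smul, inv_mul_cancel₀ ht0, one_smul]
  obtain ⟨w, hw⟩ := LinearMap.injective_iff_surjective.mp hinj ⟨z, hz⟩
  refine ⟨s w, (s w).2, ?_⟩
  have h1 : ⁅x, (s w : L)⁆ = w := congrArg Subtype.val (LinearMap.congr_fun hs w)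
  have h2 : (w : L) + t • ⁅v, (s w : L)⁆ = z := congrArg Subtype.val hw
  rw [add_lie, smul_lie, h1, h2]

/-- Exponentials of elements that commute with `h` fix `h` and preserve its `2`-eigenspace. The
component `k` in a complement of that eigenspace must therefore vanish. -/
lemma eventually_exists_lieEquiv_adEigenspace (h x v : L) (hx : x ∈ adEigenspace h 2)
    (hv : v ∈ adEigenspace h 2)
    (hgood : ∀ z ∈ adEigenspace h 2, ∃ y ∈ adEigenspace h 0, ⁅x, y⁆ = z) :
    ∀ᶠ t : ℂ in nhds 0, ∃ σ : L ≃ₗ⁅ℂ⁆ L, σ h = h ∧ σ x = x + t • v := by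
  obtain ⟨K, hK⟩ := (adEigenspace h 2).exists_isCompl
  have hsurj : ∀ z, ∃ y ∈ adEigenspace h 0, ∃ k ∈ K, z = ⁅y, x⁆ + k := by
    intro z
    obtain ⟨a, ha, k, hk, rfl⟩ := Submodule.mem_sup.mp
      (hK.sup_eq_top ▸ Submodule.mem_top (x := z))
    obtain ⟨y, hy, rfl⟩ := hgood a ha
    exact ⟨-y, neg_mem hy, k, hk, by rw [neg_lie, lie_skew]⟩
  filter_upwards [eventually_exists_isExpAd _ K x hsurj v] with t ⟨y, hy, σ, hσ, k, hk, e⟩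
  have hyh : ⁅y, h⁆ = 0 := by
    rw [← lie_skew, mem_adEigenspace.mp hy, zero_smul, neg_zero]
  refine ⟨σ, hσ.apply_of_lie_eq_zero hyh, ?_⟩
  have h1 : σ.symm (x + t • v) ∈ adEigenspace h 2 :=
    hσ.symm_map_mem _ (fun z hz => by simpa using lie_mem_adEigenspace hy hz) _
      (add_mem hx (Submodule.smul_mem _ t hv))
  rw [e, LieEquiv.symm_apply_apply] at h1
  have h2 : k ∈ adEigenspace h 2 := by simpa using sub_mem h1 hx
  have h3 : k = 0 := (Submodule.disjoint_def.mp hK.disjoint) k h2 hk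
  rw [e, h3, add_zero]

/-- Two `sl₂`-triples with the same neutral element are conjugate. -/
theorem exists_lieEquiv_of_isSl2Triple {h e f e' f' : L} (t : IsSl2Triple h e f)
    (t' : IsSl2Triple h e' f') : ∃ σ : L ≃ₗ⁅ℂ⁆ L, σ h = h ∧ σ e = e' ∧ σ f = f' := by
  have mem {e f : L} (t : IsSl2Triple h e f) : e ∈ adEigenspace h 2 :=
    mem_adEigenspace.mpr (t.lie_h_e_smul ℂ)
  have good {e f : L} (t : IsSl2Triple h e f) (z : L) (hz : z ∈ adEigenspace h 2) :
      ∃ y ∈ adEigenspace h 0, ⁅e, y⁆ = z := by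
    obtain ⟨y, hy, hy'⟩ := exists_lie_e_eq_of_lie_h_eq t (mem_adEigenspace.mp hz)
    exact ⟨y, mem_adEigenspace.mpr (by simpa using hy), hy'⟩
  have hv := sub_mem (mem t') (mem t)
  have hfin := finite_setOf_not_surjective_lie h e (e' - e) (mem t) hv (good t)
  obtain ⟨σ, hσ, hσ'⟩ := rel_of_eventually_rel hfin.countable
    (fun s t => ∃ σ : L ≃ₗ⁅ℂ⁆ L, σ h = h ∧ σ (e + s • (e' - e)) = e + t • (e' - e))
    (fun s t ⟨σ, h1, h2⟩ => ⟨σ.symm, by rw [LieEquiv.symm_apply_eq]; exact h1.symm, by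
      rw [LieEquiv.symm_apply_eq]; exact h2.symm⟩)
    (fun s t u ⟨σ, h1, h2⟩ ⟨τ, h3, h4⟩ => ⟨σ.trans τ, by simp [h1, h3], by
      rw [LieEquiv.trans_apply, h2, h4]⟩)
    (fun s hs => by
      have h1 := eventually_exists_lieEquiv_adEigenspace h (e + s • (e' - e)) (e' - e)
        (add_mem (mem t) (Submodule.smul_mem _ s hv)) hv (by simpa using hs)
      have h2 : Filter.Tendsto (fun t : ℂ => t - s) (nhds s) (nhds 0) := by
        have : Continuous (fun t : ℂ => t - s) := by fun_prop
        simpa using this.tendsto s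
      filter_upwards [h2.eventually h1] with t ⟨σ, h3, h4⟩ _
      exact ⟨σ, h3, by rw [h4]; module⟩)
    (x := 0) (y := 1) (by simpa using good t) (by simpa using good t')
  simp only [zero_smul, add_zero, one_smul, add_sub_cancel] at hσ'
  refine ⟨σ, hσ, hσ', ?_⟩
  -- `h` and `e` determine `f`: the difference `σ f - f'` is killed by `e'` and has weight `-2`,
  -- while a nonzero such vector has a natural number as weight.
  by_contra hne
  have P : t'.HasPrimitiveVectorWith (σ f - f') (-2 : ℂ) := by
    refine ⟨sub_ne_zero.mpr hne, ?_, ?_⟩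
    · have h1 : ⁅h, σ f⁆ = -((2 : ℂ) • σ f) := by
        have := congrArg σ (t.lie_lie_smul_f ℂ)
        rwa [LieEquiv.map_lie, hσ, map_neg, map_smul] at this
      rw [lie_sub, h1, t'.lie_lie_smul_f ℂ]
      module
    · have h1 : ⁅e', σ f⁆ = h := by
        rw [← hσ', ← LieEquiv.map_lie, t.lie_e_f, hσ]
      rw [lie_sub, h1, t'.lie_e_f, sub_self]
  obtain ⟨n, hn⟩ := P.exists_nat
  have h2 : ((n + 2 : ℕ) : ℂ) = 0 := by push_cast; linear_combination -hn
  exact absurd (Nat.cast_eq_zero.mp h2) (by lia)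

end TripleConjugacy

/-! ### Homomorphisms from `sl₂` and `sl₂`-triples. -/

section SlTwoHom

lemma slTwo_ext {x y : SlTwo} (h : (x : Matrix (Fin 2) (Fin 2) ℂ) = y) : x = y := Subtype.ext h

lemma slTwo_apply_one_one (x : SlTwo) : x.1 1 1 = -x.1 0 0 := by
  have h : Matrix.trace x.1 = 0 := x.2
  rw [Matrix.trace_fin_two] at h
  linear_combination h

lemma slTwo_eq (x : SlTwo) : x = x.1 0 0 • hStd + x.1 0 1 • eStd + x.1 1 0 • fStd := by
  apply slTwo_ext
  have h := slTwo_apply_one_one x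
  ext i j
  fin_cases i <;> fin_cases j <;> simp [hStd, eStd, fStd, h]

lemma slTwo_add_val (x y : SlTwo) : (x + y).1 = x.1 + y.1 := rfl

lemma slTwo_smul_val (c : ℂ) (x : SlTwo) : (c • x).1 = c • x.1 := rfl

lemma slTwo_lie_val (x y : SlTwo) : (⁅x, y⁆ : SlTwo).1 = x.1 * y.1 - y.1 * x.1 := rfl

lemma isSl2Triple_std : IsSl2Triple hStd eStd fStd where
  h_ne_zero h := by
    have := congrFun (congrFun (congrArg Subtype.val h) 0) 0
    simp [hStd] at this
  lie_e_f := by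
    apply slTwo_ext
    rw [slTwo_lie_val]
    ext i j
    fin_cases i <;> fin_cases j <;> simp [hStd, eStd, fStd]
  lie_h_e_nsmul := by
    apply slTwo_ext
    rw [slTwo_lie_val, two_nsmul]
    ext i j
    fin_cases i <;> fin_cases j <;> norm_num [hStd, eStd, fStd, Matrix.mul_apply]
  lie_h_f_nsmul := by
    apply slTwo_ext
    rw [slTwo_lie_val, two_nsmul]
    ext i j
    fin_cases i <;> fin_cases j <;> norm_num [hStd, eStd, fStd, Matrix.mul_apply]

variable {L : Type*} [LieRing L] [LieAlgebra ℂ L]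

/-- The homomorphism from `sl₂` given by an `sl₂`-triple. -/
def slTwoHom {h e f : L} (t : IsSl2Triple h e f) : SlTwo →ₗ⁅ℂ⁆ L where
  toFun x := x.1 0 0 • h + x.1 0 1 • e + x.1 1 0 • f
  map_add' x y := by
    simp only [slTwo_add_val, Matrix.add_apply]
    module
  map_smul' c x := by
    simp only [slTwo_smul_val, Matrix.smul_apply, RingHom.id_apply, smul_eq_mul]
    module
  map_lie' := by
    intro x y
    have hx := slTwo_apply_one_one x
    have hy := slTwo_apply_one_one y
    have h1 : ⁅e, h⁆ = -((2 : ℂ) • e) := by rw [← lie_skew, t.lie_h_e_smul ℂ]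
    have h2 : ⁅f, h⁆ = (2 : ℂ) • f := by rw [← lie_skew, t.lie_lie_smul_f ℂ, neg_neg]
    have h3 : ⁅f, e⁆ = -h := by rw [← lie_skew, t.lie_e_f]
    simp only [lie_add, add_lie, lie_smul, smul_lie, lie_self, h1, h2, h3, t.lie_e_f,
      t.lie_h_e_smul ℂ, t.lie_lie_smul_f ℂ, slTwo_lie_val, Matrix.sub_apply, Matrix.mul_apply,
      Fin.sum_univ_two, hx, hy]
    module

@[simp] lemma slTwoHom_h {h e f : L} (t : IsSl2Triple h e f) : slTwoHom t hStd = h := by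
  simp [slTwoHom, hStd]

@[simp] lemma slTwoHom_e {h e f : L} (t : IsSl2Triple h e f) : slTwoHom t eStd = e := by
  simp [slTwoHom, eStd]

@[simp] lemma slTwoHom_f {h e f : L} (t : IsSl2Triple h e f) : slTwoHom t fStd = f := by
  simp [slTwoHom, fStd]

lemma hom_slTwo_apply (φ : SlTwo →ₗ⁅ℂ⁆ L) (x : SlTwo) :
    φ x = x.1 0 0 • φ hStd + x.1 0 1 • φ eStd + x.1 1 0 • φ fStd := by
  conv_lhs => rw [slTwo_eq x]
  simp

lemma isSl2Triple_map (φ : SlTwo →ₗ⁅ℂ⁆ L) (h : φ hStd ≠ 0) :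
    IsSl2Triple (φ hStd) (φ eStd) (φ fStd) where
  h_ne_zero := h
  lie_e_f := by rw [← LieHom.map_lie, isSl2Triple_std.lie_e_f]
  lie_h_e_nsmul := by rw [← LieHom.map_lie, isSl2Triple_std.lie_h_e_nsmul, map_nsmul]
  lie_h_f_nsmul := by rw [← LieHom.map_lie, isSl2Triple_std.lie_h_f_nsmul, map_neg, map_nsmul]

lemma map_hStd_ne_zero {φ : SlTwo →ₗ⁅ℂ⁆ L} (hφ : Function.Injective φ) : φ hStd ≠ 0 :=
  (map_ne_zero_iff φ hφ).mpr isSl2Triple_std.h_ne_zero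

lemma injective_of_map_hStd_ne_zero {φ : SlTwo →ₗ⁅ℂ⁆ L} (h : φ hStd ≠ 0) :
    Function.Injective φ := by
  have t := isSl2Triple_map φ h
  refine (injective_iff_map_eq_zero φ).mpr fun x hx => ?_
  have hx' := hx
  rw [hom_slTwo_apply] at hx'
  set a := x.1 0 0
  set b := x.1 0 1
  set c := x.1 1 0
  have h1 : ⁅φ eStd, φ hStd⁆ = -((2 : ℂ) • φ eStd) := by rw [← lie_skew, t.lie_h_e_smul ℂ]
  have h2 : ⁅φ fStd, φ hStd⁆ = (2 : ℂ) • φ fStd := by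
    rw [← lie_skew, t.lie_lie_smul_f ℂ, neg_neg]
  have h3 : ⁅φ fStd, φ eStd⁆ = -φ hStd := by rw [← lie_skew, t.lie_e_f]
  have e1 : (-2 * a) • φ eStd + c • φ hStd = 0 := by
    have := congrArg (fun z => ⁅φ eStd, z⁆) hx'
    simp only [lie_add, lie_smul, lie_self, lie_zero, h1, t.lie_e_f] at this
    rw [← this]; module
  have hc : c = 0 := by
    have := congrArg (fun z => ⁅φ eStd, z⁆) e1
    simp only [lie_add, lie_smul, lie_self, lie_zero, h1, smul_zero, zero_add] at this
    simpa [t.e_ne_zero] using this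
  have ha : a = 0 := by
    rw [hc] at e1
    simpa [t.e_ne_zero] using e1
  have hb : b = 0 := by
    rw [ha, hc] at hx'
    simpa [t.e_ne_zero] using hx'
  rw [slTwo_eq x]
  simp [a, b, c] at ha hb hc
  simp [ha, hb, hc]

lemma areConjugate_of_map_eq {φ ψ : SlTwo →ₗ⁅ℂ⁆ L} (σ : L ≃ₗ⁅ℂ⁆ L) (hh : σ (φ hStd) = ψ hStd)
    (he : σ (φ eStd) = ψ eStd) (hf : σ (φ fStd) = ψ fStd) : AreConjugate φ ψ := by
  have h (x : SlTwo) : σ (φ x) = ψ x := by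
    rw [hom_slTwo_apply φ, hom_slTwo_apply ψ]
    simp [hh, he, hf]
  refine ⟨σ, ?_⟩
  ext z
  simp only [LieSubalgebra.mem_map, LieHom.mem_range]
  constructor
  · rintro ⟨_, ⟨x, rfl⟩, rfl⟩
    exact ⟨x, (h x).symm⟩
  · rintro ⟨x, rfl⟩
    exact ⟨_, ⟨x, rfl⟩, h x⟩

/-- Copies of `sl₂` with conjugate neutral elements are conjugate. -/
lemma areConjugate_of_map_hStd_eq [FiniteDimensional ℂ L] {φ ψ : SlTwo →ₗ⁅ℂ⁆ L}
    (hφ : Function.Injective φ) (hψ : Function.Injective ψ) (σ : L ≃ₗ⁅ℂ⁆ L)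
    (hh : σ (φ hStd) = ψ hStd) : AreConjugate φ ψ := by
  have t := isSl2Triple_map (σ.toLieHom.comp φ)
    ((map_ne_zero_iff _ σ.injective).mpr (map_hStd_ne_zero hφ))
  have t' := isSl2Triple_map ψ (map_hStd_ne_zero hψ)
  have e : (σ.toLieHom.comp φ) hStd = ψ hStd := hh
  rw [e] at t
  obtain ⟨τ, h1, h2, h3⟩ := exists_lieEquiv_of_isSl2Triple t t'
  exact areConjugate_of_map_eq (σ.trans τ) (by rw [LieEquiv.trans_apply, hh, h1]) h2 h3

/-- An invariant quadratic form on `sl₂` is a multiple of `-det`, which is `1` at `hStd`. -/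
lemma killingForm_hom_slTwo (ψ : SlTwo →ₗ⁅ℂ⁆ L) (x : SlTwo) :
    killingForm ℂ L (ψ x) (ψ x) =
      (x.1 0 0 ^ 2 + x.1 0 1 * x.1 1 0) * killingForm ℂ L (ψ hStd) (ψ hStd) := by
  have inv (a b c : SlTwo) : killingForm ℂ L (ψ ⁅a, b⁆) (ψ c) = killingForm ℂ L (ψ a) (ψ ⁅b, c⁆) := by
    rw [LieHom.map_lie, LieHom.map_lie]
    exact LieModule.traceForm_apply_lie_apply ℂ L L _ _ _
  have comm (a b : SlTwo) : killingForm ℂ L (ψ a) (ψ b) = killingForm ℂ L (ψ b) (ψ a) :=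
    LieModule.traceForm_comm ℂ L L _ _
  have t := isSl2Triple_std
  have l1 : ⁅hStd, eStd⁆ = (2 : ℂ) • eStd := t.lie_h_e_smul ℂ
  have l2 : ⁅hStd, fStd⁆ = -((2 : ℂ) • fStd) := t.lie_lie_smul_f ℂ
  have l3 : ⁅eStd, hStd⁆ = -((2 : ℂ) • eStd) := by rw [← lie_skew, l1]
  have l4 : ⁅fStd, hStd⁆ = (2 : ℂ) • fStd := by rw [← lie_skew, l2, neg_neg]
  have k1 := inv hStd eStd hStd
  have k2 := inv hStd fStd hStd
  have k3 := inv hStd eStd eStd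
  have k4 := inv hStd fStd fStd
  have k5 := inv hStd eStd fStd
  simp only [l1, l2, l3, l4, lie_self, t.lie_e_f, map_smul, map_neg, map_zero, LinearMap.smul_apply,
    LinearMap.neg_apply, smul_eq_mul] at k1 k2 k3 k4 k5
  rw [hom_slTwo_apply ψ x]
  simp only [map_add, map_smul, LinearMap.add_apply, LinearMap.smul_apply, smul_eq_mul]
  rw [comm eStd hStd] at *
  rw [comm fStd hStd] at *
  rw [comm fStd eStd] at *
  linear_combination (x.1 0 0 * x.1 0 1 / 2) * k1 - (x.1 0 0 * x.1 1 0 / 2) * k2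
    + (x.1 0 1 ^ 2 / 2) * k3 - (x.1 1 0 ^ 2 / 2) * k4 + (x.1 0 1 * x.1 1 0) * k5

/-- Conjugacy matches the subalgebras, not the standard elements: `σ (φ hStd)` is only some `ψ x`.
-/
lemma killingForm_eq_of_areConjugate {φ ψ : SlTwo →ₗ⁅ℂ⁆ L} (hφ : Function.Injective φ)
    (hψ : Function.Injective ψ) (h : AreConjugate φ ψ) :
    killingForm ℂ L (φ hStd) (φ hStd) = killingForm ℂ L (ψ hStd) (ψ hStd) := by
  obtain ⟨σ, hσ⟩ := h
  have hmem (x : SlTwo) : ∃ y, ψ y = σ (φ x) := by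
    have : σ (φ x) ∈ ψ.range := by
      rw [← hσ, LieSubalgebra.mem_map]
      exact ⟨φ x, ⟨x, rfl⟩, rfl⟩
    simpa using this
  obtain ⟨x, hx⟩ := hmem hStd
  obtain ⟨y, hy⟩ := hmem eStd
  have hxy : ⁅x, y⁆ = (2 : ℂ) • y := by
    apply hψ
    rw [LieHom.map_lie, hx, hy, ← LieEquiv.map_lie, ← LieHom.map_lie,
      isSl2Triple_std.lie_h_e_smul ℂ, map_smul, map_smul, map_smul, hy]
  have hy0 : y ≠ 0 := by
    rintro rfl
    rw [map_zero] at hy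
    refine isSl2Triple_std.e_ne_zero (hφ (σ.injective (?_ : σ (φ eStd) = σ (φ 0))))
    rw [← hy, map_zero, map_zero]
  -- The eigenvalues of `ad x` on `sl₂` are `0` and `±2 √(-det x)`, and `2` is one of them.
  have hdet : x.1 0 0 ^ 2 + x.1 0 1 * x.1 1 0 = 1 := by
    have hx1 := slTwo_apply_one_one x
    have hy1 := slTwo_apply_one_one y
    have h1 := congrArg Subtype.val hxy
    rw [slTwo_lie_val] at h1
    have h00 := congrFun (congrFun h1 0) 0
    have h01 := congrFun (congrFun h1 0) 1
    have h10 := congrFun (congrFun h1 1) 0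
    simp only [Matrix.sub_apply, Matrix.mul_apply, Fin.sum_univ_two, hx1, hy1,
      slTwo_smul_val, Matrix.smul_apply, smul_eq_mul] at h00 h01 h10
    by_contra hne
    refine hy0 ?_
    have hne' : x.1 0 0 ^ 2 + x.1 0 1 * x.1 1 0 - 1 ≠ 0 := sub_ne_zero.mpr hne
    rw [slTwo_eq y]
    have z00 : y.1 0 0 = 0 := by
      refine (mul_eq_zero.mp ?_).resolve_left hne'
      linear_combination (x.1 0 1 / 2 * h10 - x.1 1 0 / 2 * h01 + h00) / 2 - x.1 0 0 / 2 * (x.1 0 1 / 2 * h10 + x.1 1 0 / 2 * h01 + x.1 0 0 * h00)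
    have z01 : y.1 0 1 = 0 := by
      refine (mul_eq_zero.mp ?_).resolve_left hne'
      linear_combination h01 / 2 + x.1 0 0 / 2 * h01 - x.1 0 1 * h00 + x.1 0 1 / 2 * (h00 - (x.1 0 1 / 2 * h10 + x.1 1 0 / 2 * h01 + x.1 0 0 * h00))
    have z10 : y.1 1 0 = 0 := by
      refine (mul_eq_zero.mp ?_).resolve_left hne'
      linear_combination h10 / 2 - x.1 0 0 / 2 * h10 + x.1 1 0 * h00 - x.1 1 0 / 2 * (h00 + (x.1 0 1 / 2 * h10 + x.1 1 0 / 2 * h01 + x.1 0 0 * h00))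
    simp [z00, z01, z10]
  rw [← LieAlgebra.killingForm_of_equiv_apply σ, ← hx, killingForm_hom_slTwo, hdet, one_mul]

end SlTwoHom

/-! ### Arithmetic of the lattice `E₈`. -/

section EEightLattice

/-- The values of the simple roots on an integral combination of the simple coroots in type
`E₈`. -/
def e8Val (c : Fin 8 → ℤ) (i : Fin 8) : ℤ := ∑ j, CartanMatrix.E₈ i j * c j

/-- The square length of an integral combination of the simple coroots in type `E₈`. -/
def e8Form (c : Fin 8 → ℤ) : ℤ := ∑ i, c i * e8Val c i

lemma e8_symm (i j : Fin 8) : CartanMatrix.E₈ i j = CartanMatrix.E₈ j i := by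
  exact congrFun (congrFun CartanMatrix.E₈_isSymm j) i

lemma e8Val_zero (c : Fin 8 → ℤ) : e8Val c 0 = 2 * c 0 - c 2 := by
  simp [e8Val, Fin.sum_univ_eight, CartanMatrix.E₈]; ring

lemma e8Val_one (c : Fin 8 → ℤ) : e8Val c 1 = 2 * c 1 - c 3 := by
  simp [e8Val, Fin.sum_univ_eight, CartanMatrix.E₈]; ring

lemma e8Val_two (c : Fin 8 → ℤ) : e8Val c 2 = 2 * c 2 - c 0 - c 3 := by
  simp [e8Val, Fin.sum_univ_eight, CartanMatrix.E₈]; ring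

lemma e8Val_three (c : Fin 8 → ℤ) : e8Val c 3 = 2 * c 3 - c 1 - c 2 - c 4 := by
  simp [e8Val, Fin.sum_univ_eight, CartanMatrix.E₈]; ring

lemma e8Val_four (c : Fin 8 → ℤ) : e8Val c 4 = 2 * c 4 - c 3 - c 5 := by
  simp [e8Val, Fin.sum_univ_eight, CartanMatrix.E₈]; ring

lemma e8Val_five (c : Fin 8 → ℤ) : e8Val c 5 = 2 * c 5 - c 4 - c 6 := by
  simp [e8Val, Fin.sum_univ_eight, CartanMatrix.E₈]; ring

lemma e8Val_six (c : Fin 8 → ℤ) : e8Val c 6 = 2 * c 6 - c 5 - c 7 := by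
  simp [e8Val, Fin.sum_univ_eight, CartanMatrix.E₈]; ring

lemma e8Val_seven (c : Fin 8 → ℤ) : e8Val c 7 = 2 * c 7 - c 6 := by
  simp [e8Val, Fin.sum_univ_eight, CartanMatrix.E₈]; ring

lemma e8Form_eq (c : Fin 8 → ℤ) : e8Form c = c 0 * e8Val c 0 + c 1 * e8Val c 1 + c 2 * e8Val c 2 +
    c 3 * e8Val c 3 + c 4 * e8Val c 4 + c 5 * e8Val c 5 + c 6 * e8Val c 6 + c 7 * e8Val c 7 := by
  simp [e8Form, Fin.sum_univ_eight]

lemma e8Val_add_single (c : Fin 8 → ℤ) (k : Fin 8) (t : ℤ) (i : Fin 8) :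
    e8Val (c + Pi.single k t) i = e8Val c i + CartanMatrix.E₈ i k * t := by
  simp [e8Val, mul_add, Finset.sum_add_distrib, Pi.single_apply]

lemma e8Form_add_single (c : Fin 8 → ℤ) (k : Fin 8) (t : ℤ) :
    e8Form (c + Pi.single k t) = e8Form c + 2 * t * e8Val c k + 2 * t ^ 2 := by
  have h : ∑ i, c i * (CartanMatrix.E₈ i k * t) = t * e8Val c k := by
    rw [e8Val, Finset.mul_sum]
    exact Finset.sum_congr rfl fun i _ => by rw [e8_symm i k]; ring
  simp only [e8Form, e8Val_add_single, Pi.add_apply, add_mul, mul_add, Finset.sum_add_distrib, h]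
  simp [Pi.single_apply]
  ring

/-- The reflection in a simple root preserves square lengths. -/
lemma e8Form_reflect (c : Fin 8 → ℤ) (k : Fin 8) :
    e8Form (c + Pi.single k (-e8Val c k)) = e8Form c := by
  rw [e8Form_add_single]; ring

/-- The Cauchy–Schwarz inequality against the Weyl vector `ρ`: the sum of the coefficients is `(ρ,
c)`, and `(ρ, ρ) = 620`. The squares come from completing squares in `620 * e8Form c - (∑ c) ^ 2`;
there are seven because that form vanishes at `ρ`. -/
lemma sum_le_e8Form (c : Fin 8 → ℤ) : ∑ i, c i ≤ 620 * e8Form c := by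
  have h : (∑ i, c i) ^ 2 ≤ 620 * e8Form c := by
    rw [e8Form_eq]
    simp only [Fin.sum_univ_eight, e8Val_zero, e8Val_one, e8Val_two, e8Val_three, e8Val_four,
      e8Val_five, e8Val_six, e8Val_seven]
    nlinarith [sq_nonneg ((1239) * c 0 + (-1) * c 1 + (-621) * c 2 + (-1) * c 3 + (-1) * c 4 + (-1) * c 5 + (-1) * c 6 + (-1) * c 7),
    sq_nonneg ((2476) * c 1 + (-3) * c 2 + (-1241) * c 3 + (-2) * c 4 + (-2) * c 5 + (-2) * c 6 + (-2) * c 7),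
    sq_nonneg ((3705) * c 2 + (-2485) * c 3 + (-6) * c 4 + (-6) * c 5 + (-6) * c 6 + (-6) * c 7),
    sq_nonneg ((610) * c 3 + (-744) * c 4 + (-3) * c 5 + (-3) * c 6 + (-3) * c 7),
    sq_nonneg ((236) * c 4 + (-307) * c 5 + (-2) * c 6 + (-2) * c 7),
    sq_nonneg ((813) * c 5 + (-1192) * c 6 + (-12) * c 7),
    sq_nonneg ((29) * c 6 + (-57) * c 7)]
  nlinarith [sq_nonneg (∑ i, c i - 1), sq_nonneg (∑ i, c i)]

/-- A set of vectors that is stable under the simple reflections indexed by `J` at vectors where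
the simple root is negative contains, with each vector, a larger vector that is dominant for
`J`. -/
lemma exists_dominant (J : Set (Fin 8)) (p : (Fin 8 → ℤ) → Prop)
    (hp : ∀ c, ∀ i ∈ J, p c → e8Val c i < 0 → p (c + Pi.single i (-e8Val c i)))
    (c : Fin 8 → ℤ) (hc : p c) : ∃ d, p d ∧ c ≤ d ∧ ∀ i ∈ J, 0 ≤ e8Val d i := by
  -- A reflection at a negative value keeps the square length and raises the sum of the
  -- coefficients, which is bounded by `sum_le_e8Form`.
  induction hn : (620 * e8Form c - ∑ i, c i).toNat using Nat.strong_induction_on generalizing c with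
  | _ n ih =>
    by_cases hdom : ∀ i ∈ J, 0 ≤ e8Val c i
    · exact ⟨c, hc, le_rfl, hdom⟩
    push Not at hdom
    obtain ⟨i, hi, hneg⟩ := hdom
    have hsum : ∑ j, (c + Pi.single i (-e8Val c i) : Fin 8 → ℤ) j = ∑ j, c j - e8Val c i := by
      simp [Finset.sum_add_distrib, sub_eq_add_neg]
    have hle := sum_le_e8Form (c + Pi.single i (-e8Val c i))
    obtain ⟨d, hd, hcd, hdd⟩ := ih _ (by
      rw [← hn]
      have hform := e8Form_reflect c i
      rw [hform] at hle ⊢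
      rw [hsum] at hle ⊢
      omega) _ (hp c i hi hc hneg) rfl
    refine ⟨d, hd, le_trans ?_ hcd, hdd⟩
    rw [le_add_iff_nonneg_right]
    exact Pi.single_nonneg.mpr (by omega)

/-- The coefficients of the highest root of `E₈`. -/
def e8Highest : Fin 8 → ℤ := ![2, 3, 4, 6, 5, 4, 3, 2]

/-- The coefficients of the highest root of the `E₇` subsystem. -/
def e7Highest : Fin 8 → ℤ := ![2, 2, 3, 4, 3, 2, 1, 0]

/-- The inverse Cartan matrix has positive entries; the constants are its diagonal entries. -/
lemma e8_dominant_coeff (c : Fin 8 → ℤ) (hc : ∀ i, 0 ≤ e8Val c i) :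
    (∀ i, 0 ≤ c i) ∧ 4 * e8Val c 0 ≤ c 0 ∧ 8 * e8Val c 1 ≤ c 1 ∧ 14 * e8Val c 2 ≤ c 2 ∧
      30 * e8Val c 3 ≤ c 3 ∧ 20 * e8Val c 4 ≤ c 4 ∧ 12 * e8Val c 5 ≤ c 5 ∧ 6 * e8Val c 6 ≤ c 6 := by
  have h0 := hc 0
  have h1 := hc 1
  have h2 := hc 2
  have h3 := hc 3
  have h4 := hc 4
  have h5 := hc 5
  have h6 := hc 6
  have h7 := hc 7
  simp only [e8Val_zero, e8Val_one, e8Val_two, e8Val_three, e8Val_four,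
    e8Val_five, e8Val_six, e8Val_seven] at *
  refine ⟨fun i => ?_, by linarith, by linarith, by linarith, by linarith, by linarith,
    by linarith, by linarith⟩
  fin_cases i <;> simp <;> linarith

lemma eq_zero_of_mul_lt {a c k : ℤ} (hk : 0 < k) (ha : 0 ≤ a) (h : k * a ≤ c) (hac : c * a < k) : a = 0 := by
  by_contra hne
  have h1 : 1 ≤ a := by omega
  have h2 : k * a * a ≤ c * a := mul_le_mul_of_nonneg_right h ha
  have h3 : k * (1 * 1) ≤ k * (a * a) :=
    mul_le_mul_of_nonneg_left (mul_le_mul h1 h1 zero_le_one ha) hk.le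
  linarith

lemma eq_of_quadratic {a d : ℤ} (ha : 0 ≤ a) (hd : 0 ≤ d)
    (h : 4 * a ^ 2 + 4 * a * d + 2 * d ^ 2 = 2 ∨ 4 * a ^ 2 + 4 * a * d + 2 * d ^ 2 = 4) :
    (a = 0 ∧ d = 1) ∨ (a = 1 ∧ d = 0) := by
  have h0 : 4 * a ^ 2 + 4 * a * d + 2 * d ^ 2 ≤ 4 := by omega
  have had := mul_nonneg ha hd
  have ha' : a ≤ 1 := by nlinarith
  have hd' : d ≤ 1 := by nlinarith
  interval_cases a <;> interval_cases d <;> norm_num at h <;> norm_num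

/-- The dominant vectors of square length `2` and `4`. -/
lemma e8_dominant_short (c : Fin 8 → ℤ) (hc : ∀ i, 0 ≤ e8Val c i)
    (hQ : e8Form c = 2 ∨ e8Form c = 4) :
    (∀ i, e8Val c i = if i = 7 then 1 else 0) ∨ (∀ i, e8Val c i = if i = 0 then 1 else 0) := by
  obtain ⟨hpos, b0, b1, b2, b3, b4, b5, b6⟩ := e8_dominant_coeff c hc
  have hterm (i : Fin 8) : 0 ≤ c i * e8Val c i := mul_nonneg (hpos i) (hc i)
  have hle (i : Fin 8) : c i * e8Val c i ≤ 4 := by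
    have h1 : c i * e8Val c i ≤ e8Form c :=
      Finset.single_le_sum (f := fun i => c i * e8Val c i) (fun j _ => hterm j) (Finset.mem_univ i)
    omega
  -- The six middle diagonal entries exceed `4`, so these values vanish; only nodes `0` and `7`,
  -- with entries `4` and `2`, survive.
  have z1 := eq_zero_of_mul_lt (by norm_num) (hc 1) b1 (by linarith [hle 1])
  have z2 := eq_zero_of_mul_lt (by norm_num) (hc 2) b2 (by linarith [hle 2])
  have z3 := eq_zero_of_mul_lt (by norm_num) (hc 3) b3 (by linarith [hle 3])
  have z4 := eq_zero_of_mul_lt (by norm_num) (hc 4) b4 (by linarith [hle 4])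
  have z5 := eq_zero_of_mul_lt (by norm_num) (hc 5) b5 (by linarith [hle 5])
  have z6 := eq_zero_of_mul_lt (by norm_num) (hc 6) b6 (by linarith [hle 6])
  have c0 : c 0 = 4 * e8Val c 0 + 2 * e8Val c 7 := by
    simp only [e8Val_zero, e8Val_one, e8Val_two, e8Val_three, e8Val_four,
      e8Val_five, e8Val_six, e8Val_seven] at z1 z2 z3 z4 z5 z6 ⊢; omega
  have c7 : c 7 = 2 * e8Val c 0 + 2 * e8Val c 7 := by
    simp only [e8Val_zero, e8Val_one, e8Val_two, e8Val_three, e8Val_four,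
      e8Val_five, e8Val_six, e8Val_seven] at z1 z2 z3 z4 z5 z6 ⊢; omega
  have hQ' : e8Form c = 4 * e8Val c 0 ^ 2 + 4 * e8Val c 0 * e8Val c 7 + 2 * e8Val c 7 ^ 2 := by
    rw [e8Form_eq, z1, z2, z3, z4, z5, z6, c0, c7]; ring
  have hcases := eq_of_quadratic (hc 0) (hc 7) (hQ' ▸ hQ)
  rcases hcases with ⟨e0, e7⟩ | ⟨e0, e7⟩
  · left; intro i; fin_cases i <;> simp [*]
  · right; intro i; fin_cases i <;> simp [*]

lemma e8Form_of_val_seven (c : Fin 8 → ℤ) (h : ∀ i, e8Val c i = if i = 7 then 1 else 0) :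
    c = e8Highest ∧ e8Form c = 2 := by
  have hc : c = e8Highest := by
    have h0 := h 0
    have h1 := h 1
    have h2 := h 2
    have h3 := h 3
    have h4 := h 4
    have h5 := h 5
    have h6 := h 6
    have h7 := h 7
    simp [e8Val_zero, e8Val_one, e8Val_two, e8Val_three, e8Val_four,
      e8Val_five, e8Val_six, e8Val_seven] at h0 h1 h2 h3 h4 h5 h6 h7
    ext i
    fin_cases i <;> simp [e8Highest] <;> omega
  refine ⟨hc, ?_⟩
  rw [e8Form_eq]
  simp only [h]
  simp [hc, e8Highest]

/-- `ω₁` is the sum of the two orthogonal coroots that define the diagonal copy, whence the square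
length `2 + 2`. -/
lemma e8Form_of_val_zero (c : Fin 8 → ℤ) (h : ∀ i, e8Val c i = if i = 0 then 1 else 0) :
    c = e8Highest + e7Highest ∧ e8Form c = 4 := by
  have hc : c = e8Highest + e7Highest := by
    have h0 := h 0
    have h1 := h 1
    have h2 := h 2
    have h3 := h 3
    have h4 := h 4
    have h5 := h 5
    have h6 := h 6
    have h7 := h 7
    simp [e8Val_zero, e8Val_one, e8Val_two, e8Val_three, e8Val_four,
      e8Val_five, e8Val_six, e8Val_seven] at h0 h1 h2 h3 h4 h5 h6 h7
    ext i
    fin_cases i <;> simp [e8Highest, e7Highest] <;> omega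
  refine ⟨hc, ?_⟩
  rw [e8Form_eq]
  simp only [h]
  simp [hc, e8Highest, e7Highest]

/-- A nonzero dominant vector on which the highest root takes a value of at most `2`. -/
lemma e8_dominant_of_highest_le (a : Fin 8 → ℤ) (ha : ∀ i, 0 ≤ a i) (ha0 : ∃ i, a i ≠ 0)
    (h : ∑ i, e8Highest i * a i ≤ 2) :
    (∀ i, a i = if i = 7 then 1 else 0) ∨ (∀ i, a i = if i = 0 then 1 else 0) := by
  have h0 := ha 0
  have h1 := ha 1
  have h2 := ha 2
  have h3 := ha 3
  have h4 := ha 4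
  have h5 := ha 5
  have h6 := ha 6
  have h7 := ha 7
  simp [Fin.sum_univ_eight, e8Highest] at h
  simp only [Fin.exists_fin_succ, Fin.forall_fin_succ] at *
  simp at *
  omega

/-- The dominant vector of square length `2` in the `E₇` sublattice. -/
lemma e7_dominant_short (c : Fin 8 → ℤ) (hc : ∀ i ≠ 7, 0 ≤ e8Val c i) (hc7 : c 7 = 0)
    (hQ : e8Form c = 2) : c = e7Highest := by
  have h0 := hc 0 (by decide)
  have h1 := hc 1 (by decide)
  have h2 := hc 2 (by decide)
  have h3 := hc 3 (by decide)
  have h4 := hc 4 (by decide)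
  have h5 := hc 5 (by decide)
  have h6 := hc 6 (by decide)
  rw [e8Form_eq, hc7] at hQ
  -- Diagonal entries of the inverse Cartan matrix of `E₇`, rounded down; those exceeding the square
  -- length `2` after rounding are listed.
  have b : (∀ i, 0 ≤ c i) ∧ 3 * e8Val c 1 ≤ c 1 ∧ 6 * e8Val c 2 ≤ c 2 ∧ 12 * e8Val c 3 ≤ c 3 ∧
      7 * e8Val c 4 ≤ c 4 ∧ 4 * e8Val c 5 ≤ c 5 := by
    simp only [e8Val_zero, e8Val_one, e8Val_two, e8Val_three, e8Val_four,
      e8Val_five, e8Val_six] at h0 h1 h2 h3 h4 h5 h6 ⊢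
    refine ⟨fun i => ?_, by linarith, by linarith, by linarith, by linarith, by linarith⟩
    fin_cases i <;> simp <;> linarith
  obtain ⟨hpos, b1, b2, b3, b4, b5⟩ := b
  have t0 := mul_nonneg (hpos 0) h0
  have t1 := mul_nonneg (hpos 1) h1
  have t2 := mul_nonneg (hpos 2) h2
  have t3 := mul_nonneg (hpos 3) h3
  have t4 := mul_nonneg (hpos 4) h4
  have t5 := mul_nonneg (hpos 5) h5
  have t6 := mul_nonneg (hpos 6) h6
  have z1 := eq_zero_of_mul_lt (by norm_num) h1 b1 (by linarith)
  have z2 := eq_zero_of_mul_lt (by norm_num) h2 b2 (by linarith)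
  have z3 := eq_zero_of_mul_lt (by norm_num) h3 b3 (by linarith)
  have z4 := eq_zero_of_mul_lt (by norm_num) h4 b4 (by linarith)
  have z5 := eq_zero_of_mul_lt (by norm_num) h5 b5 (by linarith)
  have c0 : c 0 = 2 * e8Val c 0 + e8Val c 6 := by
    simp only [e8Val_zero, e8Val_one, e8Val_two, e8Val_three, e8Val_four,
      e8Val_five, e8Val_six] at z1 z2 z3 z4 z5 ⊢; omega
  have c6 : 2 * c 6 = 2 * e8Val c 0 + 3 * e8Val c 6 := by
    simp only [e8Val_zero, e8Val_one, e8Val_two, e8Val_three, e8Val_four,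
      e8Val_five, e8Val_six] at z1 z2 z3 z4 z5 ⊢; omega
  have hQ' : 4 * e8Val c 0 ^ 2 + 4 * e8Val c 0 * e8Val c 6 + 3 * e8Val c 6 ^ 2 = 4 := by
    rw [z1, z2, z3, z4, z5, c0] at hQ
    linear_combination 2 * hQ - e8Val c 6 * c6
  have h06 := mul_nonneg h0 h6
  have u0 : e8Val c 0 ≤ 1 := by nlinarith
  have u6 : e8Val c 6 ≤ 1 := by nlinarith
  have hv : e8Val c 0 = 1 ∧ e8Val c 6 = 0 := by
    generalize e8Val c 0 = a at *
    generalize e8Val c 6 = d at *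
    interval_cases a <;> interval_cases d <;> norm_num at hQ' <;> norm_num
  obtain ⟨v0, v6⟩ := hv
  simp only [e8Val_zero, e8Val_one, e8Val_two, e8Val_three, e8Val_four,
    e8Val_five, e8Val_six] at v0 z1 z2 z3 z4 z5 v6
  ext i
  fin_cases i <;> simp [e7Highest] <;> omega

lemma e8Val_e8Highest (i : Fin 8) : e8Val e8Highest i = if i = 7 then 1 else 0 := by
  fin_cases i <;> simp [e8Val_zero, e8Val_one, e8Val_two, e8Val_three, e8Val_four,
    e8Val_five, e8Val_six, e8Val_seven, e8Highest]

lemma e8Val_e8Highest_add_e7Highest (i : Fin 8) :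
    e8Val (e8Highest + e7Highest) i = if i = 0 then 1 else 0 := by
  fin_cases i <;> simp [e8Val_zero, e8Val_one, e8Val_two, e8Val_three, e8Val_four,
    e8Val_five, e8Val_six, e8Val_seven, e8Highest, e7Highest]

end EEightLattice

/-! ### Roots of `E₈` as lattice vectors, and highest roots. -/

section EEightRoots

lemma e8Val_injective {c d : Fin 8 → ℤ} (h : ∀ i, e8Val c i = e8Val d i) : c = d := by
  have h0 := h 0
  have h1 := h 1
  have h2 := h 2
  have h3 := h 3
  have h4 := h 4
  have h5 := h 5
  have h6 := h 6
  have h7 := h 7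
  simp only [e8Val_zero, e8Val_one, e8Val_two, e8Val_three, e8Val_four, e8Val_five, e8Val_six,
    e8Val_seven] at h0 h1 h2 h3 h4 h5 h6 h7
  ext i
  fin_cases i <;> simp <;> omega

variable {ι M N : Type*} [AddCommGroup M] [Module ℂ M] [AddCommGroup N] [Module ℂ N]
  {P : RootPairing ι ℂ M N} {b : P.Base} (ν : Fin 8 ≃ b.support)

/-- An integral combination of the simple roots. -/
def rootComb (c : Fin 8 → ℤ) : M := ∑ i, (c i : ℂ) • P.root (ν i)

/-- An integral combination of the simple coroots. -/
def corootComb (c : Fin 8 → ℤ) : N := ∑ i, (c i : ℂ) • P.coroot (ν i)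

lemma rootComb_add (c d : Fin 8 → ℤ) : rootComb ν (c + d) = rootComb ν c + rootComb ν d := by
  simp [rootComb, add_smul, Finset.sum_add_distrib]

lemma rootComb_single (k : Fin 8) (t : ℤ) :
    rootComb ν (Pi.single k t) = (t : ℂ) • P.root (ν k) := by
  rw [rootComb, Finset.sum_eq_single k] <;> simp +contextual

lemma rootComb_neg (c : Fin 8 → ℤ) : rootComb ν (-c) = -rootComb ν c := by
  simp [rootComb]

lemma rootComb_zero : rootComb ν 0 = 0 := by
  simp [rootComb]

lemma corootComb_add (c d : Fin 8 → ℤ) :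
    corootComb ν (c + d) = corootComb ν c + corootComb ν d := by
  simp [corootComb, add_smul, Finset.sum_add_distrib]

lemma corootComb_single (k : Fin 8) (t : ℤ) :
    corootComb ν (Pi.single k t) = (t : ℂ) • P.coroot (ν k) := by
  rw [corootComb, Finset.sum_eq_single k] <;> simp +contextual

lemma corootComb_neg (c : Fin 8 → ℤ) : corootComb ν (-c) = -corootComb ν c := by
  simp [corootComb]

/-- The simple roots numbered by a subset of the nodes. -/
def simpleSubset (S : Set (Fin 8)) : Set ι := {α | ∃ i, i ∈ S ∧ α = ν i}

lemma simpleSubset_univ : simpleSubset ν Set.univ = (b.support : Set ι) := by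
  ext α
  simp only [simpleSubset, Set.mem_univ, true_and, Set.mem_ofPred_eq, Finset.mem_coe]
  constructor
  · rintro ⟨i, rfl⟩; exact (ν i).2
  · intro h; exact ⟨ν.symm ⟨α, h⟩, by simp⟩

lemma exists_rootComb_of_mem_closure {S : Set (Fin 8)} {x : M}
    (hx : x ∈ AddSubmonoid.closure (P.root '' simpleSubset ν S)) :
    ∃ d : Fin 8 → ℤ, 0 ≤ d ∧ x = rootComb ν d := by
  induction hx using AddSubmonoid.closure_induction with
  | mem x hx =>
    obtain ⟨_, ⟨i, -, rfl⟩, rfl⟩ := hx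
    exact ⟨Pi.single i 1, by simp, by simp [rootComb_single]⟩
  | zero => exact ⟨0, le_rfl, (rootComb_zero ν).symm⟩
  | add x y _ _ hx hy =>
    obtain ⟨d, hd, rfl⟩ := hx
    obtain ⟨d', hd', rfl⟩ := hy
    exact ⟨d + d', add_nonneg hd hd', (rootComb_add ν d d').symm⟩

lemma exists_rootComb_of_mem_span {S : Set (Fin 8)} {x : M}
    (hx : x ∈ Submodule.span ℤ (P.root '' simpleSubset ν S)) :
    ∃ d : Fin 8 → ℤ, (∀ i ∉ S, d i = 0) ∧ x = rootComb ν d := by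
  induction hx using Submodule.span_induction with
  | mem x hx =>
    obtain ⟨_, ⟨i, hi, rfl⟩, rfl⟩ := hx
    refine ⟨Pi.single i 1, fun j hj => ?_, by simp [rootComb_single]⟩
    rw [Pi.single_apply, if_neg]
    rintro rfl
    exact hj hi
  | zero => exact ⟨0, fun _ _ => rfl, (rootComb_zero ν).symm⟩
  | add x y _ _ hx hy =>
    obtain ⟨d, hd, rfl⟩ := hx
    obtain ⟨d', hd', rfl⟩ := hy
    exact ⟨d + d', fun i hi => by simp [hd i hi, hd' i hi], (rootComb_add ν d d').symm⟩
  | smul a x _ hx =>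
    obtain ⟨d, hd, rfl⟩ := hx
    refine ⟨a • d, fun i hi => by simp [hd i hi], ?_⟩
    rw [← Int.cast_smul_eq_zsmul ℂ]
    simp [rootComb, Finset.smul_sum, mul_smul]

lemma rootComb_mem_span {S : Set (Fin 8)} {d : Fin 8 → ℤ} (hd : ∀ i ∉ S, d i = 0) :
    rootComb ν d ∈ Submodule.span ℤ (P.root '' simpleSubset ν S) := by
  refine Submodule.sum_mem _ fun i _ => ?_
  by_cases hi : i ∈ S
  · rw [Int.cast_smul_eq_zsmul]
    exact Submodule.smul_mem _ _ (Submodule.subset_span ⟨_, ⟨i, hi, rfl⟩, rfl⟩)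
  · simp [hd i hi]

lemma rootComb_mem_closure {S : Set (Fin 8)} {d : Fin 8 → ℤ} (hd : ∀ i ∉ S, d i = 0)
    (hd0 : 0 ≤ d) : rootComb ν d ∈ AddSubmonoid.closure (P.root '' simpleSubset ν S) := by
  refine AddSubmonoid.sum_mem _ fun i _ => ?_
  by_cases hi : i ∈ S
  · obtain ⟨n, hn⟩ := Int.eq_ofNat_of_zero_le (hd0 i)
    rw [hn, Int.cast_natCast, Nat.cast_smul_eq_nsmul]
    refine AddSubmonoid.nsmul_mem _ (AddSubmonoid.subset_closure ?_) n
    exact ⟨_, ⟨i, hi, rfl⟩, rfl⟩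
  · simp [hd i hi]

variable {ν} (hν : ∀ i j, P.pairing (ν i) (ν j) = (CartanMatrix.E₈ i j : ℂ))
include hν

lemma coroot'_rootComb (c : Fin 8 → ℤ) (k : Fin 8) :
    P.coroot' (ν k) (rootComb ν c) = (e8Val c k : ℂ) := by
  simp only [rootComb, map_sum, map_smul, RootPairing.root_coroot'_eq_pairing, hν, e8Val,
    smul_eq_mul]
  push_cast
  exact Finset.sum_congr rfl fun i _ => by rw [e8_symm i k, mul_comm]

lemma root'_corootComb (c : Fin 8 → ℤ) (k : Fin 8) :
    P.root' (ν k) (corootComb ν c) = (e8Val c k : ℂ) := by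
  simp only [corootComb, map_sum, map_smul, RootPairing.root'_coroot_eq_pairing, hν, e8Val,
    smul_eq_mul]
  push_cast
  exact Finset.sum_congr rfl fun i _ => by rw [mul_comm]

lemma rootComb_injective {c d : Fin 8 → ℤ} (h : rootComb ν c = rootComb ν d) : c = d := by
  refine e8Val_injective fun i => ?_
  have := congrArg (P.coroot' (ν i)) h
  rw [coroot'_rootComb hν, coroot'_rootComb hν] at this
  exact_mod_cast this

lemma root_reflectionPerm_rootComb {i : ι} {c : Fin 8 → ℤ} (h : P.root i = rootComb ν c)
    (k : Fin 8) :
    P.root (P.reflectionPerm (ν k) i) = rootComb ν (c + Pi.single k (-e8Val c k)) := by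
  rw [RootPairing.root_reflectionPerm, RootPairing.reflection_apply, h, coroot'_rootComb hν,
    rootComb_add, rootComb_single]
  push_cast
  rw [neg_smul, sub_eq_add_neg]

lemma coroot_reflectionPerm_corootComb {i : ι} {c : Fin 8 → ℤ} (h : P.coroot i = corootComb ν c)
    (k : Fin 8) :
    P.coroot (P.reflectionPerm (ν k) i) = corootComb ν (c + Pi.single k (-e8Val c k)) := by
  rw [RootPairing.coroot_reflectionPerm, RootPairing.coreflection_apply, h, root'_corootComb hν,
    corootComb_add, corootComb_single]
  push_cast
  rw [neg_smul, sub_eq_add_neg]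

variable [Finite ι] [P.IsCrystallographic] [P.IsReduced]

/-- In type `E₈` a root and its coroot have the same coefficients, and square length `2`. -/
lemma exists_root_eq_rootComb (i : ι) :
    ∃ c, P.root i = rootComb ν c ∧ P.coroot i = corootComb ν c ∧ e8Form c = 2 := by
  refine b.induction_reflect (p := fun i => ∃ c, P.root i = rootComb ν c ∧
    P.coroot i = corootComb ν c ∧ e8Form c = 2) i ?_ ?_ ?_
  · rintro i ⟨c, h1, h2, h3⟩
    refine ⟨-c, ?_, ?_, ?_⟩
    · rw [rootComb_neg, ← h1]; simp
    · rw [corootComb_neg, ← h2]; simp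
    · rw [← h3]; simp [e8Form, e8Val]
  · intro i hi
    obtain ⟨k, hk⟩ := ν.surjective ⟨i, hi⟩
    have hk' : (ν k : ι) = i := congrArg Subtype.val hk
    refine ⟨Pi.single k 1, ?_, ?_, ?_⟩
    · simp [rootComb_single, hk']
    · simp [corootComb_single, hk']
    · have := e8Form_add_single 0 k 1
      simpa [e8Form, e8Val] using this
  · rintro i j ⟨c, h1, h2, h3⟩ hj
    obtain ⟨k, hk⟩ := ν.surjective ⟨j, hj⟩
    have hk' : (ν k : ι) = j := congrArg Subtype.val hk
    refine ⟨c + Pi.single k (-e8Val c k), ?_, ?_, ?_⟩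
    · rw [← hk', root_reflectionPerm_rootComb hν h1]
    · rw [← hk', coroot_reflectionPerm_corootComb hν h2]
    · rw [e8Form_reflect, h3]

/-- Each root of the subsystem can be raised by reflections in `S` to a root that is dominant for
`S`. By hypothesis `d` is the only candidate, so `d` is a root and bounds the others. -/
lemma isHighestRoot_aux {S : Set (Fin 8)} {d : Fin 8 → ℤ} (hS : S.Nonempty)
    (hd : ∀ c, e8Form c = 2 → (∀ i ∉ S, c i = 0) → (∀ i ∈ S, 0 ≤ e8Val c i) → c = d) :
    (∃ θ, IsHighestRoot P (simpleSubset ν S) θ) ∧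
      ∀ θ, IsHighestRoot P (simpleSubset ν S) θ →
        P.root θ = rootComb ν d ∧ P.coroot θ = corootComb ν d := by
  have hcoeff (β : ι) (hβ : β ∈ subsystem P (simpleSubset ν S)) :
      ∃ c, P.root β = rootComb ν c ∧ (∀ i ∉ S, c i = 0) := by
    obtain ⟨c, hc, hc'⟩ := exists_rootComb_of_mem_span ν hβ
    exact ⟨c, hc', hc⟩
  have hdom (β : ι) (hβ : β ∈ subsystem P (simpleSubset ν S)) :
      ∃ c, P.root β = rootComb ν c ∧ (∀ i ∉ S, c i = 0) ∧ c ≤ d ∧ (∀ i ∉ S, d i = 0) ∧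
        ∃ θ, P.root θ = rootComb ν d := by
    obtain ⟨c, hc, hcS⟩ := hcoeff β hβ
    obtain ⟨c', ⟨⟨γ, hγ⟩, hc'S⟩, hle, hc'⟩ := exists_dominant S
      (fun c => (∃ γ, P.root γ = rootComb ν c) ∧ ∀ i ∉ S, c i = 0) (by
        rintro c k hk ⟨⟨γ, hγ⟩, hcS⟩ -
        refine ⟨⟨_, root_reflectionPerm_rootComb hν hγ k⟩, fun i hi => ?_⟩
        have : i ≠ k := by rintro rfl; exact hi hk
        simp [hcS i hi, this]) c ⟨⟨β, hc⟩, hcS⟩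
    have hc'd : c' = d := by
      refine hd c' ?_ hc'S hc'
      obtain ⟨c'', h1, -, h2⟩ := exists_root_eq_rootComb hν γ
      rwa [rootComb_injective hν (hγ.symm.trans h1)]
    subst hc'd
    exact ⟨c, hc, hcS, hle, hc'S, γ, hγ⟩
  obtain ⟨k, hk⟩ := hS
  have hk0 : (ν k : ι) ∈ subsystem P (simpleSubset ν S) :=
    Submodule.subset_span ⟨_, ⟨k, hk, rfl⟩, rfl⟩
  obtain ⟨-, -, -, -, hdS, θ, hθ⟩ := hdom _ hk0
  have hθh : IsHighestRoot P (simpleSubset ν S) θ := by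
    refine ⟨?_, fun β hβ => ?_⟩
    · change P.root θ ∈ Submodule.span ℤ (P.root '' simpleSubset ν S)
      rw [hθ]
      exact rootComb_mem_span ν hdS
    · obtain ⟨c, hc, hcS, hle, -⟩ := hdom β hβ
      have : P.root θ - P.root β = rootComb ν (d - c) := by
        rw [hθ, hc, sub_eq_add_neg, sub_eq_add_neg, rootComb_add, rootComb_neg]
      rw [this]
      exact rootComb_mem_closure ν (fun i hi => by simp [hdS i hi, hcS i hi]) (sub_nonneg.mpr hle)
  refine ⟨⟨θ, hθh⟩, fun θ' hθ' => ?_⟩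
  have hroot : P.root θ' = rootComb ν d := by
    obtain ⟨d', hd', e⟩ := exists_rootComb_of_mem_closure ν (hθ'.2 θ hθh.1)
    obtain ⟨c, hc, -, hle, -⟩ := hdom θ' hθ'.1
    rw [hθ, hc, sub_eq_iff_eq_add, ← rootComb_add] at e
    have := rootComb_injective hν e
    rw [hc]
    congr 1
    refine le_antisymm hle ?_
    rw [this]
    exact le_add_of_nonneg_left hd'
  refine ⟨hroot, ?_⟩
  obtain ⟨c, h1, h2, -⟩ := exists_root_eq_rootComb hν θ'
  rw [h2, rootComb_injective hν (hroot.symm.trans h1)]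

/-- The highest root of `E₈`. -/
lemma isHighestRoot_e8 : (∃ θ, IsHighestRoot P b.support θ) ∧
    ∀ θ, IsHighestRoot P b.support θ →
      P.root θ = rootComb ν e8Highest ∧ P.coroot θ = corootComb ν e8Highest := by
  rw [← simpleSubset_univ ν]
  refine isHighestRoot_aux hν Set.univ_nonempty fun c hc _ hdom => ?_
  rcases e8_dominant_short c (fun i => hdom i (Set.mem_univ i)) (.inl hc) with h | h
  · exact (e8Form_of_val_seven c h).1
  · have := (e8Form_of_val_zero c h).2
    omega

/-- The highest root of the `E₇` subsystem of `E₈`. -/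
lemma isHighestRoot_e7 :
    (∃ θ, IsHighestRoot P {α | ∃ i : Fin 8, i ≠ 7 ∧ α = ν i} θ) ∧
    ∀ θ, IsHighestRoot P {α | ∃ i : Fin 8, i ≠ 7 ∧ α = ν i} θ →
      P.root θ = rootComb ν e7Highest ∧ P.coroot θ = corootComb ν e7Highest :=
  isHighestRoot_aux hν (S := {i | i ≠ 7}) ⟨0, by simp⟩ fun c hc hc7 hdom =>
    e7_dominant_short c hdom (hc7 7 (by simp)) hc

end EEightRoots

/-- In an irreducible root system, any two roots have a common root that is orthogonal to neither
of them. -/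
lemma exists_pairing_ne_zero {ι M N : Type*} [AddCommGroup M] [Module ℂ M] [AddCommGroup N]
    [Module ℂ N] [Finite ι] (P : RootPairing ι ℂ M N) [P.IsCrystallographic] [P.IsIrreducible]
    (i j : ι) : ∃ k, P.pairing k i ≠ 0 ∧ P.pairing k j ≠ 0 := by
  by_contra! hall
  let s : Set ι := {k | P.pairing k i ≠ 0}
  have hs : Submodule.span ℂ (P.root '' s) = ⊤ := by
    -- If `k` is orthogonal to `i` but not to some `l` in `s`, then the reflection of `k` in `l` is
    -- not orthogonal to `i`, so `k` lies in the span of `s`. Irreducibility then makes `s` span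
    -- everything.
    refine P.span_root_image_eq_top_of_forall_orthogonal s ⟨i, by simp [s]⟩ fun k hk l hl => ?_
    have hk0 : P.pairing k i = 0 := by
      by_contra h
      exact hk (Submodule.subset_span ⟨k, h, rfl⟩)
    rw [RootPairing.IsOrthogonal]
    have key : P.pairing k l = 0 := by
      by_contra h
      have h1 : P.reflectionPerm l k ∈ s := by
        have h2 : P.pairing (P.reflectionPerm l k) i = - (P.pairing k l * P.pairing l i) := by
          rw [← P.root_coroot'_eq_pairing, P.root_reflectionPerm, P.reflection_apply, map_sub,
            map_smul, P.root_coroot'_eq_pairing, P.root_coroot'_eq_pairing,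
            P.root_coroot'_eq_pairing, hk0, zero_sub, smul_eq_mul]
        change P.pairing (P.reflectionPerm l k) i ≠ 0
        rw [h2]
        exact neg_ne_zero.mpr (mul_ne_zero h hl)
      have h3 : P.root k = P.root (P.reflectionPerm l k) + P.pairing k l • P.root l := by
        rw [P.root_reflectionPerm, P.reflection_apply, P.root_coroot'_eq_pairing,
          sub_add_cancel]
      refine hk ?_
      rw [h3]
      exact add_mem (Submodule.subset_span ⟨_, h1, rfl⟩)
        (Submodule.smul_mem _ _ (Submodule.subset_span ⟨l, hl, rfl⟩))
    exact ⟨key, (P.pairing_eq_zero_iff).mp key⟩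
  have h1 : (⊤ : Submodule ℂ M) ≤ LinearMap.ker (P.coroot' j) := by
    rw [← hs, Submodule.span_le]
    rintro _ ⟨k, hk, rfl⟩
    simp [P.root_coroot'_eq_pairing, hall k hk]
  have h2 : P.coroot' j (P.root j) = 0 := h1 Submodule.mem_top
  simp [P.root_coroot'_eq_pairing] at h2

/-! ### The Killing form, reflections and weights on a Cartan subalgebra. -/

section KillingForm

open LieModule

variable {L : Type*} [LieRing L] [LieAlgebra ℂ L] {H : LieSubalgebra ℂ L}

lemma killingForm_coe_eq_traceForm (x y : H) :
    killingForm ℂ L (x : L) (y : L) = traceForm ℂ H L x y := rfl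

lemma mem_rootSpace_of_lie_eq_smul [LieRing.IsNilpotent H] {χ : H → ℂ} {x : L}
    (hx : ∀ h : H, ⁅(h : L), x⁆ = χ h • x) : x ∈ rootSpace H χ :=
  weightSpace_le_genWeightSpace L χ ((mem_weightSpace χ x).mpr hx)

variable [FiniteDimensional ℂ L] [LieAlgebra.IsKilling ℂ L] [H.IsCartanSubalgebra]

lemma killingForm_coroot_self_ne_zero (α : H.root) :
    killingForm ℂ L (coroot α.1 : H) (coroot α.1 : H) ≠ 0 := by
  have hα := LieSubalgebra.isNonZero_coe_root α
  rw [killingForm_coe_eq_traceForm, traceForm_coroot, root_apply_coroot hα]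
  have := root_apply_cartanEquivDual_symm_ne_zero hα
  simp [this]

lemma killingForm_coroot_apply (α : H.root) (x : H) :
    2 * killingForm ℂ L (coroot α.1 : H) x =
      α.1 x * killingForm ℂ L (coroot α.1 : H) (coroot α.1 : H) := by
  have hα := LieSubalgebra.isNonZero_coe_root α
  rw [killingForm_coe_eq_traceForm, killingForm_coe_eq_traceForm, traceForm_coroot,
    traceForm_coroot, root_apply_coroot hα]
  simp
  ring

/-- Two roots that are not orthogonal have equally long coroots exactly when their pairing is
symmetric. -/
lemma root_coroot_mul_comm (α β : H.root) :
    α.1 (coroot β.1) * killingForm ℂ L (coroot α.1 : H) (coroot α.1 : H) =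
      β.1 (coroot α.1) * killingForm ℂ L (coroot β.1 : H) (coroot β.1 : H) := by
  rw [← killingForm_coroot_apply, ← killingForm_coroot_apply]
  congr 1
  exact LieModule.traceForm_comm ℂ L L _ _

/-- An automorphism that maps one Cartan subalgebra onto another maps coroots to coroots. -/
lemma exists_lieEquiv_coroot_eq {H' : LieSubalgebra ℂ L} [H'.IsCartanSubalgebra] (σ : L ≃ₗ⁅ℂ⁆ L)
    (hσ : ∀ z, z ∈ H' ↔ σ z ∈ H) (α : H'.root) :
    ∃ β : H.root, σ (coroot α.1 : H') = (coroot β.1 : H) := by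
  have hα := LieSubalgebra.isNonZero_coe_root α
  obtain ⟨h, e, f, t, he, hf⟩ := exists_isSl2Triple_of_weight_isNonZero hα
  have hh := t.h_eq_coroot hα he hf
  have hinv (z : H) : σ.symm z ∈ H' := by rw [hσ]; simp
  let χ : H → ℂ := fun z => α.1 ⟨σ.symm z, hinv z⟩
  have hmem {c : ℂ} {x : L} (hx : ∀ y : H', ⁅(y : L), x⁆ = (c * α.1 y) • x) (z : H) :
      ⁅(z : L), σ x⁆ = (c * χ z) • σ x := by
    rw [← map_smul, ← hx ⟨σ.symm z, hinv z⟩, LieEquiv.map_lie]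
    simp
  have he' : σ e ∈ rootSpace H χ := mem_rootSpace_of_lie_eq_smul fun z => by
    simpa using hmem (c := 1) (fun y => by
      rw [one_mul]; exact lie_eq_smul_of_mem_rootSpace he y) z
  have hf' : σ f ∈ rootSpace H (-χ) := mem_rootSpace_of_lie_eq_smul fun z => by
    simpa using hmem (c := -1) (fun y => by
      rw [neg_one_mul]; exact lie_eq_smul_of_mem_rootSpace hf y) z
  have t' : IsSl2Triple (σ h) (σ e) (σ f) :=
    ⟨(map_ne_zero_iff _ σ.injective).mpr t.h_ne_zero, by rw [← LieEquiv.map_lie, t.lie_e_f],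
      by rw [← LieEquiv.map_lie, t.lie_h_e_nsmul, map_nsmul],
      by rw [← LieEquiv.map_lie, t.lie_h_f_nsmul, map_neg, map_nsmul]⟩
  have hne : genWeightSpace L χ ≠ ⊥ := by
    intro h0
    have : σ e ∈ (⊥ : LieSubmodule ℂ H L) := h0 ▸ he'
    exact t'.e_ne_zero (by simpa using this)
  let β : Weight ℂ H L := ⟨χ, hne⟩
  have hβ : β.IsNonZero := by
    intro h0
    have h2 : χ ⟨σ h, (hσ h).mp (hh ▸ (coroot α.1).2)⟩ = 0 := congrFun h0 _
    have h3 : α.1 (coroot α.1) = 0 := by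
      rw [← h2]
      simp only [χ]
      congr 1
      exact Subtype.ext (by simp [hh])
    rw [root_apply_coroot hα] at h3
    exact two_ne_zero h3
  exact ⟨⟨β, by simpa using hβ⟩, by rw [← hh]; exact t'.h_eq_coroot (α := β) hβ he' hf'⟩

/-- The reflection in a root is induced by an automorphism of the Lie algebra. -/
lemma exists_lieEquiv_reflection (α : H.root) :
    ∃ σ : L ≃ₗ⁅ℂ⁆ L, ∀ x : H, σ x = ((x - α.1 x • coroot α.1 : H) : L) := by
  have hα := LieSubalgebra.isNonZero_coe_root α
  obtain ⟨h, e, f, t, he, hf⟩ := exists_isSl2Triple_of_weight_isNonZero hα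
  have hh := t.h_eq_coroot hα he hf
  obtain ⟨σ, hσ⟩ := exists_isExpAd e
  obtain ⟨τ, hτ⟩ := exists_isExpAd (-f)
  have lhe := t.lie_h_e_smul ℂ
  have lhf := t.lie_lie_smul_f ℂ
  have lef := t.lie_e_f
  have leh : ⁅e, h⁆ = -((2 : ℂ) • e) := by rw [← lie_skew, lhe]
  have lfh : ⁅f, h⁆ = (2 : ℂ) • f := by rw [← lie_skew, lhf, neg_neg]
  have lfe : ⁅f, e⁆ = -h := by rw [← lie_skew, lef]
  have s1 : σ h = h - (2 : ℂ) • e := by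
    rw [hσ.apply_of_lie_lie_lie h (by simp [leh]), leh]; simp; abel
  have s2 : σ e = e := hσ.apply_of_lie_eq_zero (lie_self e)
  have t1 : τ h = h - (2 : ℂ) • f := by
    rw [hτ.apply_of_lie_lie_lie h (by simp [lfh])]; simp [lfh]; abel
  have t2 : τ e = e + h - f := by
    rw [hτ.apply_of_lie_lie_lie e (by simp [lfe, lfh])]; simp [lfe, lfh]; module
  -- The product `exp (ad e) exp (-ad f) exp (ad e)` represents the Weyl element of `SL₂`: it
  -- negates `h` and fixes the kernel of `α`.
  have key : σ (τ (σ h)) = -h := by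
    have h1 : τ (σ h) = -h - (2 : ℂ) • e := by
      rw [s1, map_sub, map_smul, t1, t2]; module
    rw [h1, map_sub, map_neg, map_smul, s1, s2]; module
  refine ⟨(σ.trans τ).trans σ, fun x => ?_⟩
  let x₀ : H := x - (α.1 x / 2) • coroot α.1
  have hx₀ : α.1 x₀ = 0 := by
    have : Weight.toLinear ℂ H L α.1 x₀ = 0 := by
      simp only [x₀, map_sub, map_smul]
      simp [root_apply_coroot hα]
    exact this
  have e0 : ⁅e, (x₀ : L)⁆ = 0 := by
    have : ⁅(x₀ : L), e⁆ = α.1 x₀ • e := lie_eq_smul_of_mem_rootSpace he x₀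
    rw [← lie_skew, this, hx₀, zero_smul, neg_zero]
  have f0 : ⁅-f, (x₀ : L)⁆ = 0 := by
    have : ⁅(x₀ : L), f⁆ = (-α.1 : H → ℂ) x₀ • f := lie_eq_smul_of_mem_rootSpace hf x₀
    rw [neg_lie, lie_skew, this, Pi.neg_apply, hx₀, neg_zero, zero_smul]
  have hx : (x : L) = x₀ + (α.1 x / 2) • h := by
    rw [hh]; simp [x₀]
  have hfix : σ (τ (σ (x₀ : L))) = x₀ := by
    rw [hσ.apply_of_lie_eq_zero e0, hτ.apply_of_lie_eq_zero f0, hσ.apply_of_lie_eq_zero e0]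
  have hgoal : ((x - α.1 x • coroot α.1 : H) : L) = x₀ - (α.1 x / 2) • h := by
    rw [hh]
    have : (x - α.1 x • coroot α.1 : H) = x₀ - (α.1 x / 2) • coroot α.1 := by
      simp only [x₀]; module
    rw [this]; rfl
  rw [hgoal, LieEquiv.trans_apply, LieEquiv.trans_apply, hx]
  simp only [map_add, map_smul, hfix, key]
  module

/-- The weights of a copy of `sl₂` are zero and the values of the roots. -/
lemma isWeight_iff (φ : SlTwo →ₗ⁅ℂ⁆ L) [Nontrivial L] (x : H) (hx : φ hStd = x) (μ : ℂ) :
    IsWeight φ μ ↔ μ = 0 ∨ ∃ α : H.root, α.1 x = μ := by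
  rw [IsWeight, hx]
  constructor
  · intro hμ
    by_contra! hc
    obtain ⟨hμ0, hroot⟩ := hc
    have hall (α : Weight ℂ H L) : α x ≠ μ := by
      by_cases hα : α.IsZero
      · rw [hα.eq]; exact hμ0.symm
      · exact hroot ⟨α, by simpa using hα⟩
    -- The eigenspaces for the other values already fill `L`, so by independence none is left for
    -- `μ`.
    have htop : (⊤ : Submodule ℂ L) ≤ ⨆ (ν : ℂ) (_ : ν ≠ μ), (ad ℂ L x).eigenspace ν := by
      have h3 := congrArg LieSubmodule.toSubmodule (LieModule.iSup_genWeightSpace_eq_top' ℂ H L)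
      rw [LieSubmodule.iSup_toSubmodule, LieSubmodule.top_toSubmodule] at h3
      rw [← h3]
      refine iSup_le fun α => ?_
      refine le_trans ?_ (le_iSup₂_of_le (α x) (hall α) le_rfl)
      intro v hv
      rw [Module.End.mem_eigenspace_iff]
      exact lie_eq_smul_of_mem_rootSpace hv x
    have hdisj := (ad ℂ L x).eigenspaces_iSupIndep μ
    rw [top_le_iff.mp htop, disjoint_top] at hdisj
    exact hμ hdisj
  · have hne (α : Weight ℂ H L) : (ad ℂ L x).HasEigenvalue (α x) := by
      obtain ⟨v, hv, hv0⟩ := α.exists_ne_zero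
      exact Module.End.hasEigenvalue_of_hasEigenvector
        ⟨Module.End.mem_eigenspace_iff.mpr (lie_eq_smul_of_mem_rootSpace hv x), hv0⟩
    rintro (rfl | ⟨α, rfl⟩)
    · have := hne (0 : Weight ℂ H L)
      simpa using this
    · exact hne α.1

end KillingForm

/-! ### Normalized invariant forms. -/

section RootSystem

variable {ι M N : Type*} [AddCommGroup M] [Module ℂ M] [AddCommGroup N] [Module ℂ N]
  {P : RootPairing ι ℂ M N}

/-- Invariance under the reflection in `i`, which negates the coroot of `i`. Since coroots span, `B`
is determined by its values `B (P.coroot i) (P.coroot i)`. -/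
lemma IsNormalizedForm.apply_coroot {B : LinearMap.BilinForm ℂ N} (hB : IsNormalizedForm P B)
    (i : ι) (x : N) :
    2 * B (P.coroot i) x = P.root' i x * B (P.coroot i) (P.coroot i) := by
  have h := hB.weyl_invariant i (P.coroot i) x
  rw [P.coreflection_apply_self, P.coreflection_apply, map_neg, LinearMap.neg_apply, map_sub,
    map_smul, smul_eq_mul] at h
  linear_combination -h

/-- If the roots of an irreducible root system have the same length, then a normalized form takes
the value `2` at all coroots. -/
lemma IsNormalizedForm.apply_coroot_self {B : LinearMap.BilinForm ℂ N} (hB : IsNormalizedForm P B)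
    [Finite ι] [P.IsCrystallographic] [P.IsIrreducible]
    (hP : ∀ i j, P.pairing i j = P.pairing j i) (i : ι) : B (P.coroot i) (P.coroot i) = 2 := by
  have hadj (i j : ι) (hij : P.pairing i j ≠ 0) :
      B (P.coroot i) (P.coroot i) = B (P.coroot j) (P.coroot j) := by
    have h1 := hB.apply_coroot i (P.coroot j)
    have h2 := hB.apply_coroot j (P.coroot i)
    rw [P.root'_coroot_eq_pairing] at h1 h2
    rw [hB.symm, h1, ← hP i j] at h2
    exact mul_left_cancel₀ hij h2
  obtain ⟨j, hj⟩ := hB.attained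
  obtain ⟨k, hk, hk'⟩ := exists_pairing_ne_zero P i j
  rw [← hadj k i hk, hadj k j hk', hj]

end RootSystem

/-! ### The Dynkin index through the Killing form. -/

section Index

variable {L : Type*} [LieRing L] [LieAlgebra ℂ L] [FiniteDimensional ℂ L]
  [LieAlgebra.IsSimple ℂ L] {H : LieSubalgebra ℂ L} [H.IsCartanSubalgebra]

lemma isNormalizedForm_smul_traceForm {K : ℂ} (hK0 : K ≠ 0)
    (hK : ∀ α : H.root, killingForm ℂ L (coroot α.1 : H) (coroot α.1 : H) = K) :
    IsNormalizedForm (rootSystem H) ((2 / K) • LieModule.traceForm ℂ H L) := by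
  have hself (α : H.root) : ((2 / K) • LieModule.traceForm ℂ H L) ((rootSystem H).coroot α)
      ((rootSystem H).coroot α) = 2 := by
    rw [LinearMap.smul_apply, LinearMap.smul_apply, rootSystem_coroot_apply,
      ← killingForm_coe_eq_traceForm, hK, smul_eq_mul, div_mul_cancel₀ _ hK0]
  refine ⟨fun x y => ?_, fun α x y => ?_, ?_, fun α => ?_⟩
  · simp only [LinearMap.smul_apply]
    rw [LieModule.traceForm_comm]
  · have h1 := killingForm_coroot_apply α x
    have h2 := killingForm_coroot_apply α y
    have h3 := hK α
    simp only [killingForm_coe_eq_traceForm] at h1 h2 h3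
    have h4 := LieModule.traceForm_comm ℂ H L x (coroot α.1)
    have e (x : H) : (rootSystem H).coreflection α x = x - α.1 x • coroot α.1 := rfl
    rw [e, e]
    simp only [LinearMap.smul_apply, map_sub, map_smul, LinearMap.sub_apply, smul_eq_mul, h4]
    rw [h3] at h1 h2 ⊢
    linear_combination (2 / K) * (-α.1 y / 2 * h1 - α.1 x / 2 * h2)
  · have := RootPairing.IsIrreducible.nontrivial (P := rootSystem H)
    obtain ⟨x, hx⟩ := exists_ne (0 : Module.Dual ℂ H)
    have : Nonempty H.root := by
      by_contra h
      rw [not_nonempty_iff] at h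
      have := RootPairing.IsRootSystem.span_root_eq_top (P := rootSystem H)
      rw [Set.range_eq_empty, Submodule.span_empty] at this
      have hx' : x ∈ (⊥ : Submodule ℂ (Module.Dual ℂ H)) := this ▸ Submodule.mem_top
      exact hx (by simpa using hx')
    exact ⟨this.some, hself _⟩
  · rw [hself]; simp

/-- The index of a copy of `sl₂` in a simple Lie algebra with roots of one length. -/
lemma hasDynkinIndex_iff {K : ℂ}
    (hK : ∀ α : H.root, killingForm ℂ L (coroot α.1 : H) (coroot α.1 : H) = K) (hK0 : K ≠ 0)
    {φ : SlTwo →ₗ⁅ℂ⁆ L} (hφ : Function.Injective φ) (d : ℂ) :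
    HasDynkinIndex φ d ↔ killingForm ℂ L (φ hStd) (φ hStd) = d * K := by
  -- The index is defined through an arbitrary Cartan subalgebra that contains `φ hStd`; conjugacy
  -- carries the common length of the coroots over to it.
  have hK' (H' : LieSubalgebra ℂ L) (_ : H'.IsCartanSubalgebra) (α : H'.root) :
      killingForm ℂ L (coroot α.1 : H') (coroot α.1 : H') = K := by
    obtain ⟨σ, hσ⟩ := exists_lieEquiv_isCartanSubalgebra H' H
    obtain ⟨β, hβ⟩ := exists_lieEquiv_coroot_eq σ hσ α
    rw [← LieAlgebra.killingForm_of_equiv_apply σ, hβ, hK]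
  constructor
  · rintro ⟨H', hH', hmem, B, hB, rfl⟩
    have hP (α β : H'.root) : (rootSystem H').pairing α β = (rootSystem H').pairing β α := by
      have h := root_coroot_mul_comm α β
      rw [hK' H' hH', hK' H' hH'] at h
      exact mul_right_cancel₀ hK0 h
    have hBκ : B = (2 / K) • LieModule.traceForm ℂ H' L := by
      refine LinearMap.ext_on_range (v := (rootSystem H').coroot)
        RootPairing.IsRootSystem.span_coroot_eq_top fun α => LinearMap.ext fun x => ?_
      have h1 := hB.apply_coroot α x
      rw [hB.apply_coroot_self hP] at h1
      have h2 := killingForm_coroot_apply α x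
      rw [hK' H' hH', killingForm_coe_eq_traceForm] at h2
      have h3 : (rootSystem H').root' α x = α.1 x := rfl
      rw [h3] at h1
      rw [LinearMap.smul_apply, LinearMap.smul_apply, rootSystem_coroot_apply, smul_eq_mul]
      rw [rootSystem_coroot_apply] at h1
      field_simp
      linear_combination (K / 2) * h1 - h2
    have : killingForm ℂ L (φ hStd) (φ hStd) =
      LieModule.traceForm ℂ H' L ⟨φ hStd, hmem⟩ ⟨φ hStd, hmem⟩ := rfl
    rw [this, hBκ]
    simp only [LinearMap.smul_apply, smul_eq_mul]
    field_simp
  · intro h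
    obtain ⟨H', hH', hmem⟩ := (isSl2Triple_map φ (map_hStd_ne_zero hφ)).exists_isCartanSubalgebra
    refine ⟨H', hH', hmem, _, isNormalizedForm_smul_traceForm hK0 (hK' H' hH'), ?_⟩
    have : LieModule.traceForm ℂ H' L ⟨φ hStd, hmem⟩ ⟨φ hStd, hmem⟩ = d * K := h
    simp only [LinearMap.smul_apply, smul_eq_mul, this]
    field_simp

end Index

/-! ### Even and odd values of the roots. -/

section Parity

variable {ι M N : Type*} [AddCommGroup M] [Module ℂ M] [AddCommGroup N] [Module ℂ N] [Finite ι]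
  (P : RootPairing ι ℂ M N) [P.IsCrystallographic]

/-- Two roots that are not orthogonal have a sum or a difference that is a root, unless they are
proportional. -/
lemma exists_root_eq_add_or_sub {i j : ι} (hij : P.pairing i j ≠ 0) (h1 : i ≠ j)
    (h2 : P.root i ≠ -P.root j) :
    ∃ k, P.root k = P.root i + P.root j ∨ P.root k = P.root i - P.root j := by
  have h : P.pairingIn ℤ i j ≠ 0 := by
    intro h
    refine hij ?_
    rw [← P.algebraMap_pairingIn ℤ, h, map_zero]
  rcases lt_or_gt_of_ne h with h | h
  · obtain ⟨k, hk⟩ := P.root_add_root_mem_of_pairingIn_neg h h2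
    exact ⟨k, .inl hk⟩
  · obtain ⟨k, hk⟩ := P.root_sub_root_mem_of_pairingIn_pos h h1
    exact ⟨k, .inr hk⟩

/-- If the roots take integral values at `x`, and `1` and `-1` are the only odd values, which
occur, then there are no even values other than `0`, `2` and `-2`. -/
lemma root'_apply_mem_of_odd [P.IsIrreducible] {x : N} {f : ι → ℤ}
    (hf : ∀ i, P.root' i x = (f i : ℂ)) (hodd : ∃ i, Odd (f i))
    (h1 : ∀ i, Odd (f i) → f i = 1 ∨ f i = -1) (i : ι) :
    f i = 0 ∨ f i = 1 ∨ f i = -1 ∨ f i = 2 ∨ f i = -2 := by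
  have hval (i j k : ι) (h : P.root k = P.root i + P.root j ∨ P.root k = P.root i - P.root j) :
      f k = f i + f j ∨ f k = f i - f j := by
    have hr (i : ι) : P.toLinearMap (P.root i) x = (f i : ℂ) := hf i
    rcases h with h | h
    · left
      have := hr k
      rw [h, map_add, LinearMap.add_apply, hr, hr] at this
      exact_mod_cast this.symm
    · right
      have := hr k
      rw [h, map_sub, LinearMap.sub_apply, hr, hr] at this
      exact_mod_cast this.symm
  have hcomb (i j : ι) (hij : P.pairing i j ≠ 0) (hi : Even (f i)) (hj : Odd (f j)) :
      ∃ k, (P.root k = P.root i + P.root j ∨ P.root k = P.root i - P.root j) ∧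
        (f k = f i + f j ∨ f k = f i - f j) := by
    have hne : i ≠ j := by
      rintro rfl
      exact Int.not_even_iff_odd.mpr hj hi
    have hne' : P.root i ≠ -P.root j := by
      intro h
      have h2 : P.toLinearMap (P.root i) x = (f i : ℂ) := hf i
      have h3 : P.toLinearMap (P.root j) x = (f j : ℂ) := hf j
      rw [h, map_neg, LinearMap.neg_apply, h3] at h2
      have h4 : -f j = f i := by exact_mod_cast h2
      rw [← h4, even_neg] at hi
      exact Int.not_even_iff_odd.mpr hj hi
    obtain ⟨k, hk⟩ := exists_root_eq_add_or_sub P hij hne hne'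
    exact ⟨k, hk, hval i j k hk⟩
  rcases Int.even_or_odd (f i) with hi | hi
  swap
  · rcases h1 i hi with h | h <;> simp [h]
  -- If the odd root `j` is orthogonal to `i`, a root `k` orthogonal to neither links them. Either
  -- `k` is odd, or `k ± j` is an odd root whose pairing with `i` is that of `k`.
  obtain ⟨j, hj, hij⟩ : ∃ j, Odd (f j) ∧ P.pairing i j ≠ 0 := by
    obtain ⟨j, hj⟩ := hodd
    by_cases hij : P.pairing i j = 0
    swap
    · exact ⟨j, hj, hij⟩
    obtain ⟨k, hki, hkj⟩ := exists_pairing_ne_zero P i j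
    rcases Int.even_or_odd (f k) with hk | hk
    swap
    · exact ⟨k, hk, fun h => hki (P.pairing_eq_zero_iff.mp h)⟩
    obtain ⟨l, hl, hl'⟩ := hcomb k j hkj hk hj
    refine ⟨l, ?_, fun h => hki ?_⟩
    · rcases hl' with h | h <;> rw [h]
      · exact hk.add_odd hj
      · exact hk.sub_odd hj
    · have h2 := P.pairing_eq_zero_iff.mp h
      have h3 := P.pairing_eq_zero_iff.mp hij
      rw [← P.root_coroot'_eq_pairing] at h2 h3 ⊢
      rcases hl with h | h <;> rw [h] at h2
      · rwa [map_add, h3, add_zero] at h2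
      · rwa [map_sub, h3, sub_zero] at h2
  obtain ⟨k, -, hk⟩ := hcomb i j hij hi hj
  have hk' : Odd (f k) := by
    rcases hk with h | h <;> rw [h]
    · exact hi.add_odd hj
    · exact hi.sub_odd hj
  have := h1 k hk'
  have := h1 j hj
  omega

end Parity

/-- A vector of integers is the vector of values of the simple roots on an integral combination of
the simple coroots, since the lattice `E₈` is unimodular. -/
lemma exists_e8Val_eq (a : Fin 8 → ℤ) : ∃ c, ∀ i, e8Val c i = a i := by
  refine ⟨![
    4 * a 0 + 5 * a 1 + 7 * a 2 + 10 * a 3 + 8 * a 4 + 6 * a 5 + 4 * a 6 + 2 * a 7,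
    5 * a 0 + 8 * a 1 + 10 * a 2 + 15 * a 3 + 12 * a 4 + 9 * a 5 + 6 * a 6 + 3 * a 7,
    7 * a 0 + 10 * a 1 + 14 * a 2 + 20 * a 3 + 16 * a 4 + 12 * a 5 + 8 * a 6 + 4 * a 7,
    10 * a 0 + 15 * a 1 + 20 * a 2 + 30 * a 3 + 24 * a 4 + 18 * a 5 + 12 * a 6 + 6 * a 7,
    8 * a 0 + 12 * a 1 + 16 * a 2 + 24 * a 3 + 20 * a 4 + 15 * a 5 + 10 * a 6 + 5 * a 7,
    6 * a 0 + 9 * a 1 + 12 * a 2 + 18 * a 3 + 15 * a 4 + 12 * a 5 + 8 * a 6 + 4 * a 7,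
    4 * a 0 + 6 * a 1 + 8 * a 2 + 12 * a 3 + 10 * a 4 + 8 * a 5 + 6 * a 6 + 3 * a 7,
    2 * a 0 + 3 * a 1 + 4 * a 2 + 6 * a 3 + 5 * a 4 + 4 * a 5 + 3 * a 6 + 2 * a 7], fun i => ?_⟩
  fin_cases i <;>
    simp [e8Val_zero, e8Val_one, e8Val_two, e8Val_three, e8Val_four, e8Val_five, e8Val_six,
      e8Val_seven] <;> ring

lemma corootComb_zero {ι M N : Type*} [AddCommGroup M] [Module ℂ M] [AddCommGroup N] [Module ℂ N]
    {P : RootPairing ι ℂ M N} {b : P.Base} (ν : Fin 8 ≃ b.support) : corootComb ν 0 = 0 := by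
  simp [corootComb]

lemma isWeight_of_lieEquiv {L : Type*} [LieRing L] [LieAlgebra ℂ L] {φ : SlTwo →ₗ⁅ℂ⁆ L} (σ : L ≃ₗ⁅ℂ⁆ L)
    (μ : ℂ) :
    IsWeight (σ.toLieHom.comp φ) μ ↔ IsWeight φ μ := by
  simp only [IsWeight, Module.End.HasEigenvalue, Module.End.HasUnifEigenvalue, ne_eq,
    Submodule.eq_bot_iff, not_iff_not]
  have h1 (x : L) : ⁅(σ.toLieHom.comp φ) hStd, σ x⁆ = σ ⁅φ hStd, x⁆ := by
    rw [LieEquiv.map_lie]; rfl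
  constructor
  · intro h x hx
    rw [Module.End.mem_eigenspace_iff, ad_apply] at hx
    refine (map_eq_zero_iff _ σ.injective).mp (h (σ x) ?_)
    rw [Module.End.mem_eigenspace_iff, ad_apply, h1, hx, map_smul]
  · intro h x hx
    rw [Module.End.mem_eigenspace_iff, ad_apply] at hx
    obtain ⟨y, rfl⟩ : ∃ y, σ y = x := σ.surjective x
    rw [h1, ← map_smul] at hx
    rw [h y (by rw [Module.End.mem_eigenspace_iff, ad_apply]; exact σ.injective hx), map_zero]

/-! ### Dominant representatives of neutral elements in type `E₈`. -/

section EEight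

variable {L : Type*} [LieRing L] [LieAlgebra ℂ L] [FiniteDimensional ℂ L]
  [LieAlgebra.IsSimple ℂ L] {H : LieSubalgebra ℂ L} [H.IsCartanSubalgebra]
  {b : (rootSystem H).Base} {ν : Fin 8 ≃ b.support}

lemma IsNumberingEEight.pairing_eq (hν : IsNumberingEEight b ν) (i j : Fin 8) :
    (rootSystem H).pairing (ν i) (ν j) = (CartanMatrix.E₈ i j : ℂ) := by
  rw [← hν i j]
  exact (b.algebraMap_cartanMatrixIn_apply ℤ (ν i) (ν j)).symm

lemma IsNumberingEEight.root_apply_corootComb (hν : IsNumberingEEight b ν) {α : H.root}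
    {c : Fin 8 → ℤ} (hα : (rootSystem H).root α = rootComb ν c) (d : Fin 8 → ℤ) :
    α.1 (corootComb ν d) = ((∑ i, c i * e8Val d i : ℤ) : ℂ) := by
  have h : α.1 (corootComb ν d) = (rootSystem H).root α (corootComb ν d) := rfl
  rw [h, hα, rootComb, LinearMap.sum_apply]
  push_cast
  refine Finset.sum_congr rfl fun i _ => ?_
  rw [LinearMap.smul_apply, smul_eq_mul]
  congr 1
  exact root'_corootComb hν.pairing_eq d i

/-- The Killing form on the lattice spanned by the coroots. -/
lemma IsNumberingEEight.exists_killingForm_eq (hν : IsNumberingEEight b ν) : ∃ K : ℂ, K ≠ 0 ∧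
    (∀ α : H.root, killingForm ℂ L (coroot α.1 : H) (coroot α.1 : H) = K) ∧
    ∀ d, 2 * killingForm ℂ L (corootComb ν d : H) (corootComb ν d : H) = e8Form d * K := by
  let q (i : Fin 8) : ℂ := killingForm ℂ L (coroot (ν i).1.1 : H) (coroot (ν i).1.1 : H)
  have hpair (i j : Fin 8) : (ν i).1.1 (coroot (ν j).1.1) = (CartanMatrix.E₈ i j : ℂ) :=
    hν.pairing_eq i j
  have hadj (i j : Fin 8) (hij : CartanMatrix.E₈ i j ≠ 0) : q i = q j := by
    have h := root_coroot_mul_comm (ν i).1 (ν j).1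
    rw [hpair, hpair, e8_symm j i] at h
    exact mul_left_cancel₀ (by exact_mod_cast hij) h
  -- Lengths agree along the edges of the Dynkin diagram, which is connected.
  have hq (i : Fin 8) : q i = q 0 := by
    have h2 : q 2 = q 0 := hadj _ _ (by decide)
    have h3 : q 3 = q 0 := (hadj 3 2 (by decide)).trans h2
    have h1 : q 1 = q 0 := (hadj 1 3 (by decide)).trans h3
    have h4 : q 4 = q 0 := (hadj 4 3 (by decide)).trans h3
    have h5 : q 5 = q 0 := (hadj 5 4 (by decide)).trans h4
    have h6 : q 6 = q 0 := (hadj 6 5 (by decide)).trans h5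
    have h7 : q 7 = q 0 := (hadj 7 6 (by decide)).trans h6
    fin_cases i <;> first | rfl | assumption
  have hform (d : Fin 8 → ℤ) : 2 * killingForm ℂ L (corootComb ν d : H) (corootComb ν d : H) =
      e8Form d * q 0 := by
    have h1 (i : Fin 8) : 2 * killingForm ℂ L (coroot (ν i).1.1 : H) (corootComb ν d : H) =
        e8Val d i * q 0 := by
      rw [killingForm_coroot_apply]
      change _ * q i = _
      rw [hq]
      congr 1
      exact root'_corootComb hν.pairing_eq d i
    have h2 : killingForm ℂ L (corootComb ν d : H) (corootComb ν d : H) =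
        ∑ i, (d i : ℂ) * killingForm ℂ L (coroot (ν i).1.1 : H) (corootComb ν d : H) := by
      simp only [killingForm_coe_eq_traceForm]
      conv_lhs => enter [1]; rw [corootComb]
      simp only [map_sum, map_smul, LinearMap.sum_apply, LinearMap.smul_apply, smul_eq_mul]
      rfl
    rw [h2, Finset.mul_sum, e8Form]
    push_cast
    rw [Finset.sum_mul]
    exact Finset.sum_congr rfl fun i _ => by linear_combination (d i : ℂ) * h1 i
  refine ⟨q 0, killingForm_coroot_self_ne_zero _, fun α => ?_, hform⟩
  obtain ⟨c, -, hc, hc2⟩ := exists_root_eq_rootComb hν.pairing_eq α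
  rw [rootSystem_coroot_apply] at hc
  rw [hc]
  have h := hform c
  rw [hc2] at h
  push_cast at h
  exact mul_left_cancel₀ two_ne_zero h

/-- The neutral element of a copy of `sl₂` is conjugate to a dominant element of the coroot
lattice. -/
lemma IsNumberingEEight.exists_lieEquiv_eq_corootComb (hν : IsNumberingEEight b ν)
    {φ : SlTwo →ₗ⁅ℂ⁆ L} (hφ : Function.Injective φ) :
    ∃ (σ : L ≃ₗ⁅ℂ⁆ L) (d : Fin 8 → ℤ), σ (φ hStd) = (corootComb ν d : H) ∧
      (∀ i, 0 ≤ e8Val d i) ∧ ∃ i, e8Val d i ≠ 0 := by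
  have h0 := map_hStd_ne_zero hφ
  have t := isSl2Triple_map φ h0
  obtain ⟨H', hH', hmem⟩ := t.exists_isCartanSubalgebra
  obtain ⟨σ, hσ⟩ := exists_lieEquiv_isCartanSubalgebra H' H
  let x : H := ⟨σ (φ hStd), (hσ _).mp hmem⟩
  -- A root vector, pulled back by `σ`, is an eigenvector of the neutral element of the triple, so
  -- its eigenvalue is an integer.
  have hint (i : Fin 8) : ∃ z : ℤ, (ν i).1.1 x = z := by
    obtain ⟨v, hv, hv0⟩ := (ν i).1.1.exists_ne_zero
    have h1 : ⁅(x : L), v⁆ = (ν i).1.1 x • v := lie_eq_smul_of_mem_rootSpace hv x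
    refine exists_int_of_lie_h_eq_smul t (m := σ.symm v) ?_
      ((map_ne_zero_iff _ σ.symm.injective).mpr hv0)
    refine σ.injective (?_ : σ _ = σ _)
    rw [LieEquiv.map_lie, map_smul]
    simpa using h1
  choose a ha using hint
  obtain ⟨c, hc⟩ := exists_e8Val_eq a
  have hx : x = corootComb ν c := by
    have hpp : Function.Injective (rootSystem H).flip.toLinearMap :=
      (LinearMap.IsPerfPair.bijective_left (rootSystem H).flip.toLinearMap).injective
    refine hpp (LinearMap.ext_on_range (v := (rootSystem H).root)
        RootPairing.IsRootSystem.span_root_eq_top fun α => ?_)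
    obtain ⟨e, he, -⟩ := exists_root_eq_rootComb hν.pairing_eq α
    rw [he]
    change rootComb ν e x = rootComb ν e (corootComb ν c)
    simp only [rootComb, LinearMap.sum_apply, LinearMap.smul_apply]
    refine Finset.sum_congr rfl fun i _ => ?_
    congr 1
    have h1 := root'_corootComb hν.pairing_eq c i
    rw [hc, ← ha] at h1
    exact h1.symm
  obtain ⟨d, ⟨τ, hτ⟩, -, hd⟩ := exists_dominant Set.univ
    (fun c => ∃ τ : L ≃ₗ⁅ℂ⁆ L, τ (φ hStd) = (corootComb ν c : H)) (by
      rintro c i - ⟨τ, hτ⟩ -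
      obtain ⟨ρ, hρ⟩ := exists_lieEquiv_reflection (ν i).1
      refine ⟨τ.trans ρ, ?_⟩
      rw [LieEquiv.trans_apply, hτ, hρ, corootComb_add, corootComb_single]
      congr 1
      have h1 : (ν i).1.1 (corootComb ν c) = (e8Val c i : ℂ) :=
        root'_corootComb hν.pairing_eq c i
      rw [h1]
      push_cast
      rw [neg_smul, sub_eq_add_neg]
      rfl) c ⟨σ, by rw [← hx]⟩
  refine ⟨τ, d, hτ, fun i => hd i (Set.mem_univ i), ?_⟩
  by_contra! hz
  have hd0 : d = 0 := e8Val_injective fun i => by rw [hz i]; simp [e8Val]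
  rw [hd0, corootComb_zero] at hτ
  exact (map_ne_zero_iff _ τ.injective).mpr h0 hτ

/-- The weights of a copy of `sl₂` whose neutral element is conjugate to an element of the coroot
lattice. -/
lemma isWeight_iff_of_lieEquiv {φ : SlTwo →ₗ⁅ℂ⁆ L} {σ : L ≃ₗ⁅ℂ⁆ L} {d : Fin 8 → ℤ}
    (hσ : σ (φ hStd) = (corootComb ν d : H)) (μ : ℂ) :
    IsWeight φ μ ↔ μ = 0 ∨ ∃ α : H.root, α.1 (corootComb ν d) = μ := by
  have : Nontrivial L := LieAlgebra.IsSimple.nontrivial ℂ L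
  rw [← isWeight_of_lieEquiv σ, isWeight_iff _ _ hσ]

lemma IsNumberingEEight.le_e8Highest (hν : IsNumberingEEight b ν) {α : H.root} {c : Fin 8 → ℤ}
    (hα : (rootSystem H).root α = rootComb ν c) : c ≤ e8Highest := by
  obtain ⟨⟨θ, hθ⟩, h⟩ := isHighestRoot_e8 hν.pairing_eq
  have hθ' := (h θ hθ).1
  rw [← simpleSubset_univ ν] at hθ
  obtain ⟨d, hd, e⟩ := exists_rootComb_of_mem_closure ν (hθ.2 α (by
    change (rootSystem H).root α ∈ Submodule.span ℤ _
    rw [hα]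
    exact rootComb_mem_span ν (by simp)))
  rw [hθ', hα, sub_eq_iff_eq_add, ← rootComb_add] at e
  rw [rootComb_injective hν.pairing_eq e]
  exact le_add_of_nonneg_left hd

end EEight

/-! ### The two model copies. -/

section Copies

variable {L : Type*} [LieRing L] [LieAlgebra ℂ L] [FiniteDimensional ℂ L]
  [LieAlgebra.IsSimple ℂ L] {H : LieSubalgebra ℂ L} [H.IsCartanSubalgebra]

lemma exists_isRootCopy (α : H.root) : ∃ φ, IsRootCopy α φ := by
  have hα := LieSubalgebra.isNonZero_coe_root α
  obtain ⟨h, e, f, t, he, hf⟩ := exists_isSl2Triple_of_weight_isNonZero hα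
  refine ⟨slTwoHom t, ?_, by simpa using he, by simpa using hf⟩
  rw [slTwoHom_h]
  exact t.h_eq_coroot hα he hf

variable {b : (rootSystem H).Base} {ν : Fin 8 ≃ b.support}

lemma IsNumberingEEight.exists_isHighestRootCopy (hν : IsNumberingEEight b ν) :
    ∃ ψ, IsHighestRootCopy b ψ := by
  obtain ⟨⟨θ, hθ⟩, -⟩ := isHighestRoot_e8 hν.pairing_eq
  obtain ⟨ψ, hψ⟩ := exists_isRootCopy θ
  exact ⟨ψ, θ, hθ, hψ⟩

lemma IsNumberingEEight.map_hStd_of_isHighestRootCopy (hν : IsNumberingEEight b ν)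
    {ψ : SlTwo →ₗ⁅ℂ⁆ L} (hψ : IsHighestRootCopy b ψ) :
    ψ hStd = (corootComb ν e8Highest : H) := by
  obtain ⟨θ, hθ, h, -⟩ := hψ
  rw [h, ((isHighestRoot_e8 hν.pairing_eq).2 θ hθ).2]

lemma IsNumberingEEight.map_hStd_of_isDiagonalCopy (hν : IsNumberingEEight b ν)
    {ψ : SlTwo →ₗ⁅ℂ⁆ L} (hψ : IsDiagonalCopy b ν ψ) :
    ψ hStd = (corootComb ν (e8Highest + e7Highest) : H) := by
  obtain ⟨θ, θ', φ₁, φ₂, hθ, hθ', ⟨h₁, -⟩, ⟨h₂, -⟩, h⟩ := hψ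
  rw [h, h₁, h₂, ((isHighestRoot_e8 hν.pairing_eq).2 θ hθ).2,
    ((isHighestRoot_e7 hν.pairing_eq).2 θ' hθ').2, corootComb_add]
  rfl

/-- A nonzero bracket would make `c + d` a weight, hence zero or a root, of square length `0` or
`2`. This lets the two factors of the diagonal copy commute. -/
lemma IsNumberingEEight.lie_eq_zero (hν : IsNumberingEEight b ν) {x y : L} {c d : Fin 8 → ℤ}
    (hx : x ∈ rootSpace H (rootComb ν c : Module.Dual ℂ H))
    (hy : y ∈ rootSpace H (rootComb ν d : Module.Dual ℂ H)) (hcd : e8Form (c + d) = 4) :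
    ⁅x, y⁆ = 0 := by
  by_contra hxy
  have h := lie_mem_genWeightSpace_of_mem_genWeightSpace hx hy
  have hne : rootSpace H ((rootComb ν c : Module.Dual ℂ H) + (rootComb ν d : Module.Dual ℂ H) :
      H → ℂ) ≠ ⊥ := by
    intro h0
    exact hxy (by simpa using h0.le h)
  let γ : LieModule.Weight ℂ H L := ⟨_, hne⟩
  have hγ : LieModule.Weight.toLinear ℂ H L γ = rootComb ν (c + d) := by
    rw [rootComb_add]
    rfl
  have hγ0 : γ.IsNonZero := by
    intro h0
    have h1 : rootComb ν (c + d) = (0 : Module.Dual ℂ H) := by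
      rw [← hγ]
      ext z
      exact congrFun h0 z
    rw [← rootComb_zero ν] at h1
    rw [rootComb_injective hν.pairing_eq h1] at hcd
    simp [e8Form] at hcd
  obtain ⟨e, he, -, he2⟩ := exists_root_eq_rootComb hν.pairing_eq ⟨γ, by simpa using hγ0⟩
  have h2 : rootComb ν (c + d) = (rootComb ν e : Module.Dual ℂ H) := by
    rw [← hγ, ← he]
    rfl
  rw [rootComb_injective hν.pairing_eq h2, he2] at hcd
  norm_num at hcd

lemma IsNumberingEEight.exists_isDiagonalCopy (hν : IsNumberingEEight b ν) :
    ∃ ψ, IsDiagonalCopy b ν ψ := by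
  obtain ⟨⟨θ, hθ⟩, hθ8⟩ := isHighestRoot_e8 hν.pairing_eq
  obtain ⟨⟨θ', hθ'⟩, hθ7⟩ := isHighestRoot_e7 hν.pairing_eq
  obtain ⟨r, s⟩ := hθ8 θ hθ
  obtain ⟨r', s'⟩ := hθ7 θ' hθ'
  obtain ⟨φ₁, hφ₁⟩ := exists_isRootCopy θ
  obtain ⟨φ₂, hφ₂⟩ := exists_isRootCopy θ'
  have hcomm (x y : SlTwo) : ⁅φ₁ x, φ₂ y⁆ = 0 := by
    obtain ⟨h₁, he₁, hf₁⟩ := hφ₁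
    obtain ⟨h₂, he₂, hf₂⟩ := hφ₂
    have hspace {α : H.root} {c : Fin 8 → ℤ} (hα : (rootSystem H).root α = rootComb ν c) :
        (α.1 : H → ℂ) = (rootComb ν c : Module.Dual ℂ H) ∧
          (-α.1 : H → ℂ) = (rootComb ν (-c) : Module.Dual ℂ H) := by
      rw [rootComb_neg, ← hα]
      exact ⟨rfl, rfl⟩
    have z₁ : θ'.1 (corootComb ν e8Highest) = 0 := by
      rw [hν.root_apply_corootComb r']
      simp [e8Val_e8Highest, e7Highest]
    have z₂ : θ.1 (corootComb ν e7Highest) = 0 := by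
      rw [hν.root_apply_corootComb r]
      simp [Fin.sum_univ_eight, e8Val_zero, e8Val_one, e8Val_two, e8Val_three, e8Val_four,
        e8Val_five, e8Val_six, e8Val_seven, e8Highest, e7Highest]
    have hh : ⁅φ₁ hStd, φ₂ hStd⁆ = 0 := by
      rw [h₁, h₂, ← LieSubalgebra.coe_bracket, trivial_lie_zero, ZeroMemClass.coe_zero]
    have he : ⁅φ₁ hStd, φ₂ eStd⁆ = 0 := by
      rw [h₁, s]
      exact (lie_eq_smul_of_mem_rootSpace he₂ _).trans (by rw [z₁, zero_smul])
    have hf : ⁅φ₁ hStd, φ₂ fStd⁆ = 0 := by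
      rw [h₁, s]
      exact (lie_eq_smul_of_mem_rootSpace hf₂ _).trans (by rw [Pi.neg_apply, z₁, neg_zero, zero_smul])
    have eh : ⁅φ₁ eStd, φ₂ hStd⁆ = 0 := by
      rw [← lie_skew, neg_eq_zero, h₂, s']
      exact (lie_eq_smul_of_mem_rootSpace he₁ _).trans (by rw [z₂, zero_smul])
    have fh : ⁅φ₁ fStd, φ₂ hStd⁆ = 0 := by
      rw [← lie_skew, neg_eq_zero, h₂, s']
      exact (lie_eq_smul_of_mem_rootSpace hf₁ _).trans (by rw [Pi.neg_apply, z₂, neg_zero, zero_smul])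
    rw [(hspace r).1] at he₁
    rw [(hspace r).2] at hf₁
    rw [(hspace r').1] at he₂
    rw [(hspace r').2] at hf₂
    -- The two highest roots are orthogonal, so all four sums `±θ ± θ'` have square length `4`.
    have ee := hν.lie_eq_zero he₁ he₂ (by decide)
    have ef := hν.lie_eq_zero he₁ hf₂ (by decide)
    have fe := hν.lie_eq_zero hf₁ he₂ (by decide)
    have ff := hν.lie_eq_zero hf₁ hf₂ (by decide)
    rw [hom_slTwo_apply φ₁, hom_slTwo_apply φ₂]
    simp only [lie_add, add_lie, lie_smul, smul_lie, hh, he, hf, eh, fh, ee, ef, fe, ff, smul_zero,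
      add_zero]
  refine ⟨{ (φ₁ : SlTwo →ₗ[ℂ] L) + (φ₂ : SlTwo →ₗ[ℂ] L) with
    map_lie' := ?_ }, θ, θ', φ₁, φ₂, hθ, hθ', hφ₁, hφ₂, fun x => rfl⟩
  intro x y
  change φ₁ ⁅x, y⁆ + φ₂ ⁅x, y⁆ = ⁅φ₁ x + φ₂ x, φ₁ y + φ₂ y⁆
  have h : ⁅φ₂ x, φ₁ y⁆ = 0 := by rw [← lie_skew, hcomm, neg_zero]
  rw [LieHom.map_lie, LieHom.map_lie, lie_add, add_lie, add_lie, hcomm, h, add_zero, zero_add]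

lemma IsNumberingEEight.isFundamental (hν : IsNumberingEEight b ν) {x : L} {d : Fin 8 → ℤ}
    (hx : x = (corootComb ν d : H)) {k : Fin 8} (hd : ∀ i, e8Val d i = if i = k then 1 else 0) :
    IsFundamental b ν k x := by
  subst hx
  refine ⟨(corootComb ν d).2, fun j => ?_⟩
  have h : (rootSystem H).root (ν j) (corootComb ν d) = (e8Val d j : ℂ) :=
    root'_corootComb hν.pairing_eq d j
  rw [hd] at h
  simpa using h

lemma IsNumberingEEight.injective (hν : IsNumberingEEight b ν) {ψ : SlTwo →ₗ⁅ℂ⁆ L} {d : Fin 8 → ℤ}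
    (hψ : ψ hStd = (corootComb ν d : H)) {k : Fin 8} (hd : e8Val d k ≠ 0) :
    Function.Injective ψ := by
  refine injective_of_map_hStd_ne_zero fun h => hd ?_
  have h1 : corootComb ν d = (0 : H) := Subtype.ext (hψ.symm.trans h)
  have h2 := root'_corootComb hν.pairing_eq d k
  rw [h1, map_zero] at h2
  exact_mod_cast h2.symm

/-- The index of a copy of `sl₂` whose neutral element is conjugate to an element of the coroot
lattice. -/
lemma IsNumberingEEight.hasDynkinIndex_iff (hν : IsNumberingEEight b ν) {φ : SlTwo →ₗ⁅ℂ⁆ L}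
    (hφ : Function.Injective φ) {σ : L ≃ₗ⁅ℂ⁆ L} {d : Fin 8 → ℤ}
    (hσ : σ (φ hStd) = (corootComb ν d : H)) (n : ℤ) :
    HasDynkinIndex φ n ↔ e8Form d = 2 * n := by
  obtain ⟨K, hK0, hK, hform⟩ := hν.exists_killingForm_eq
  rw [SlTwoCopies.hasDynkinIndex_iff hK hK0 hφ, ← LieAlgebra.killingForm_of_equiv_apply σ, hσ,
    ← mul_right_inj' (two_ne_zero (α := ℂ)), hform, ← mul_assoc, mul_left_inj' hK0]
  exact_mod_cast Iff.rfl

end Copies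

/-! ### Weights of a copy with dominant neutral element. -/

section Equivalence

variable {L : Type*} [LieRing L] [LieAlgebra ℂ L] [FiniteDimensional ℂ L]
  [LieAlgebra.IsSimple ℂ L] {H : LieSubalgebra ℂ L} [H.IsCartanSubalgebra]
  {b : (rootSystem H).Base} {ν : Fin 8 ≃ b.support} (hν : IsNumberingEEight b ν)
  {φ : SlTwo →ₗ⁅ℂ⁆ L} {σ : L ≃ₗ⁅ℂ⁆ L} {d : Fin 8 → ℤ} (hσ : σ (φ hStd) = (corootComb ν d : H))
include hν hσ

lemma IsNumberingEEight.isWeight_mem_of_odd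
    (h1 : IsWeight φ 1) (hodd : ∀ k : ℤ, Odd k → IsWeight φ (k : ℂ) → k = 1 ∨ k = -1) (μ : ℂ)
    (hμ : IsWeight φ μ) : μ ∈ ({0, 1, -1, 2, -2} : Set ℂ) := by
  have hint (α : H.root) : ∃ z : ℤ, α.1 (corootComb ν d) = z := by
    obtain ⟨c, hc, -⟩ := exists_root_eq_rootComb hν.pairing_eq α
    exact ⟨_, hν.root_apply_corootComb hc d⟩
  choose f hf using hint
  have hw (α : H.root) : IsWeight φ (f α : ℂ) :=
    (isWeight_iff_of_lieEquiv hσ _).mpr (.inr ⟨α, hf α⟩)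
  rcases (isWeight_iff_of_lieEquiv hσ μ).mp hμ with rfl | ⟨α, rfl⟩
  · simp
  rw [hf]
  have hex : ∃ α, Odd (f α) := by
    rcases (isWeight_iff_of_lieEquiv hσ 1).mp h1 with h | ⟨β, hβ⟩
    · exact absurd h one_ne_zero
    · rw [hf] at hβ
      have hβ' : f β = 1 := by exact_mod_cast hβ
      exact ⟨β, by rw [hβ']; exact odd_one⟩
  rcases root'_apply_mem_of_odd (rootSystem H) hf hex (fun α hα => hodd _ hα (hw α)) α with
    h | h | h | h | h <;> simp [h]

lemma IsNumberingEEight.eq_highest_of_isWeight_mem (hd : ∀ i, 0 ≤ e8Val d i)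
    (hd0 : ∃ i, e8Val d i ≠ 0)
    (h : ∀ μ : ℂ, IsWeight φ μ → μ ∈ ({0, 1, -1, 2, -2} : Set ℂ)) :
    d = e8Highest ∨ d = e8Highest + e7Highest := by
  obtain ⟨⟨θ, hθ⟩, hθ8⟩ := isHighestRoot_e8 hν.pairing_eq
  have hθd := hν.root_apply_corootComb (hθ8 θ hθ).1 d
  have hmem := h _ ((isWeight_iff_of_lieEquiv hσ _).mpr (.inr ⟨θ, hθd⟩))
  simp only [Set.mem_insert_iff, Set.mem_singleton_iff] at hmem
  have hle : ∑ i, e8Highest i * e8Val d i ≤ 2 := by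
    rcases hmem with h | h | h | h | h <;> norm_cast at h <;> omega
  rcases e8_dominant_of_highest_le _ hd hd0 hle with h | h
  · exact .inl (e8Form_of_val_seven d h).1
  · exact .inr (e8Form_of_val_zero d h).1

/-- A root takes at the fundamental coweight `d` the value of its `k`-th coefficient, which lies
between `-2` and `2`; the simple root `ν k` and its negative give `1` and `-1`. -/
lemma IsNumberingEEight.odd_isWeight {k : Fin 8} (hk : e8Highest k = 2)
    (hd : ∀ i, e8Val d i = if i = k then 1 else 0) :
    IsWeight φ 1 ∧ IsWeight φ (-1) ∧
      ∀ k : ℤ, Odd k → IsWeight φ (k : ℂ) → k = 1 ∨ k = -1 := by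
  have hval {α : H.root} {c : Fin 8 → ℤ} (hα : (rootSystem H).root α = rootComb ν c) :
      α.1 (corootComb ν d) = (c k : ℂ) := by
    rw [hν.root_apply_corootComb hα]
    simp [hd]
  have hsimple : (rootSystem H).root (ν k) = rootComb ν (Pi.single k 1) := by
    simp [rootComb_single]
  have hneg (α : H.root) {c : Fin 8 → ℤ} (hα : (rootSystem H).root α = rootComb ν c) :
      (rootSystem H).root ((rootSystem H).reflectionPerm α α) = rootComb ν (-c) := by
    rw [rootComb_neg, ← hα, RootPairing.root_reflectionPerm, RootPairing.reflection_apply_self]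
  refine ⟨(isWeight_iff_of_lieEquiv hσ _).mpr (.inr ⟨_, (hval hsimple).trans (by simp)⟩),
    (isWeight_iff_of_lieEquiv hσ _).mpr
      (.inr ⟨_, (hval (hneg _ hsimple)).trans (by simp)⟩), fun n hn hw => ?_⟩
  rcases (isWeight_iff_of_lieEquiv hσ _).mp hw with h | ⟨α, hα⟩
  · have : n = 0 := by exact_mod_cast h
    simp [this] at hn
  · obtain ⟨c, hc, -⟩ := exists_root_eq_rootComb hν.pairing_eq α
    have h1 : c k ≤ e8Highest k := hν.le_e8Highest hc k
    have h2 : -c k ≤ e8Highest k := hν.le_e8Highest (hneg α hc) k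
    rw [hval hc] at hα
    have h3 : c k = n := by exact_mod_cast hα
    obtain ⟨m, hm⟩ := hn
    omega

end Equivalence

end SlTwoCopies

end

theorem mainTheorem6 {L : Type*} [LieRing L] [LieAlgebra ℂ L] [FiniteDimensional ℂ L]
    [LieAlgebra.IsSimple ℂ L] (H : LieSubalgebra ℂ L) [H.IsCartanSubalgebra]
    (b : (LieAlgebra.IsKilling.rootSystem H).Base) (ν : Fin 8 ≃ b.support)
    (hν : SlTwoCopies.IsNumberingEEight b ν) :
    (∃ ψ : SlTwoCopies.SlTwo →ₗ⁅ℂ⁆ L, SlTwoCopies.IsHighestRootCopy b ψ) ∧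
    (∃ ψ : SlTwoCopies.SlTwo →ₗ⁅ℂ⁆ L, SlTwoCopies.IsDiagonalCopy b ν ψ) ∧
    (∀ ψ : SlTwoCopies.SlTwo →ₗ⁅ℂ⁆ L, SlTwoCopies.IsHighestRootCopy b ψ →
      Function.Injective ψ ∧ SlTwoCopies.HasDynkinIndex ψ 1 ∧
        SlTwoCopies.IsFundamental b ν 7 (ψ SlTwoCopies.hStd)) ∧
    (∀ ψ : SlTwoCopies.SlTwo →ₗ⁅ℂ⁆ L, SlTwoCopies.IsDiagonalCopy b ν ψ →
      Function.Injective ψ ∧ SlTwoCopies.HasDynkinIndex ψ 2 ∧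
        SlTwoCopies.IsFundamental b ν 0 (ψ SlTwoCopies.hStd)) ∧
    ∀ ψ₁ ψ₂ : SlTwoCopies.SlTwo →ₗ⁅ℂ⁆ L,
      SlTwoCopies.IsHighestRootCopy b ψ₁ → SlTwoCopies.IsDiagonalCopy b ν ψ₂ →
      ∀ φ : SlTwoCopies.SlTwo →ₗ⁅ℂ⁆ L, Function.Injective φ →
        List.TFAE [
          SlTwoCopies.IsWeight φ 1 ∧ SlTwoCopies.IsWeight φ (-1) ∧
            ∀ k : ℤ, Odd k → SlTwoCopies.IsWeight φ (k : ℂ) → k = 1 ∨ k = -1,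
          ∀ μ : ℂ, SlTwoCopies.IsWeight φ μ → μ ∈ ({0, 1, -1, 2, -2} : Set ℂ),
          SlTwoCopies.HasDynkinIndex φ 1 ∨ SlTwoCopies.HasDynkinIndex φ 2,
          SlTwoCopies.AreConjugate φ ψ₁ ∨ SlTwoCopies.AreConjugate φ ψ₂] := by
  open SlTwoCopies in
  have hone {ψ : SlTwo →ₗ⁅ℂ⁆ L} (h : IsHighestRootCopy b ψ) :
      Function.Injective ψ ∧ HasDynkinIndex ψ 1 ∧ IsFundamental b ν 7 (ψ hStd) := by
    have hψ := hν.map_hStd_of_isHighestRootCopy h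
    have hinj := hν.injective hψ (k := 7) (by simp [e8Val_e8Highest])
    refine ⟨hinj, ?_, hν.isFundamental hψ e8Val_e8Highest⟩
    have := (hν.hasDynkinIndex_iff hinj (σ := LieEquiv.refl) hψ 1).mpr
      (e8Form_of_val_seven _ e8Val_e8Highest).2
    simpa using this
  open SlTwoCopies in
  have htwo {ψ : SlTwo →ₗ⁅ℂ⁆ L} (h : IsDiagonalCopy b ν ψ) :
      Function.Injective ψ ∧ HasDynkinIndex ψ 2 ∧ IsFundamental b ν 0 (ψ hStd) := by
    have hψ := hν.map_hStd_of_isDiagonalCopy h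
    have hinj := hν.injective hψ (k := 0) (by simp [e8Val_e8Highest_add_e7Highest])
    refine ⟨hinj, ?_, hν.isFundamental hψ e8Val_e8Highest_add_e7Highest⟩
    have := (hν.hasDynkinIndex_iff hinj (σ := LieEquiv.refl) hψ 2).mpr
      (e8Form_of_val_zero _ e8Val_e8Highest_add_e7Highest).2
    simpa using this
  refine ⟨hν.exists_isHighestRootCopy, hν.exists_isDiagonalCopy, fun ψ => hone, fun ψ => htwo,
    fun ψ₁ ψ₂ h₁ h₂ φ hφ => ?_⟩
  obtain ⟨hinj₁, hind₁, -⟩ := hone h₁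
  obtain ⟨hinj₂, hind₂, -⟩ := htwo h₂
  obtain ⟨σ, d, hσ, hd, hd0⟩ := hν.exists_lieEquiv_eq_corootComb hφ
  obtain ⟨K, hK0, hK, -⟩ := hν.exists_killingForm_eq
  tfae_have 1 → 2 := fun h => hν.isWeight_mem_of_odd hσ h.1 h.2.2
  tfae_have 2 → 4 := fun h => by
    rcases hν.eq_highest_of_isWeight_mem hσ hd hd0 h with rfl | rfl
    · exact .inl (SlTwoCopies.areConjugate_of_map_hStd_eq hφ hinj₁ σ
        (hσ.trans (hν.map_hStd_of_isHighestRootCopy h₁).symm))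
    · exact .inr (SlTwoCopies.areConjugate_of_map_hStd_eq hφ hinj₂ σ
        (hσ.trans (hν.map_hStd_of_isDiagonalCopy h₂).symm))
  tfae_have 4 → 3 := by
    rintro (h | h)
    · left
      rw [SlTwoCopies.hasDynkinIndex_iff hK hK0 hφ,
        SlTwoCopies.killingForm_eq_of_areConjugate hφ hinj₁ h]
      exact (SlTwoCopies.hasDynkinIndex_iff hK hK0 hinj₁ 1).mp hind₁
    · right
      rw [SlTwoCopies.hasDynkinIndex_iff hK hK0 hφ,
        SlTwoCopies.killingForm_eq_of_areConjugate hφ hinj₂ h]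
      exact (SlTwoCopies.hasDynkinIndex_iff hK hK0 hinj₂ 2).mp hind₂
  tfae_have 3 → 1 := fun h => by
    have hform : SlTwoCopies.e8Form d = 2 ∨ SlTwoCopies.e8Form d = 4 := by
      have e1 := hν.hasDynkinIndex_iff hφ hσ 1
      have e2 := hν.hasDynkinIndex_iff hφ hσ 2
      push_cast at e1 e2
      rw [e1, e2] at h
      exact h
    -- The nodes `7` and `0` are those at which the highest root has coefficient `2`; this is what
    -- `rfl` checks.
    rcases SlTwoCopies.e8_dominant_short d hd hform with h | h
    · exact hν.odd_isWeight hσ rfl h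
    · exact hν.odd_isWeight hσ rfl h
  tfae_finish
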